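/- Let $m\ge 1$ and let $\mathfrak b_1,\dots,\mathfrak b_m,\mathfrak s$ be linear subspaces of $\mathfrak{gl}_n(\mathbb R)$ such that the sum $\mathfrak b=\mathfrak b_1\oplus\dots\oplus\mathfrak b_m$ is direct; for $b\in\mathfrak b$ write $b=b_1+\dots+b_m$ with $b_i\in\mathfrak b_i$. Let $[A,B]=AB-BA$, $\mathrm{ad}_A B=[A,B]$, and let $b_\star\in\mathfrak b$ be such that $$\mathfrak g:=\mathfrak b+\mathrm{ad}_{b_\star}(\mathfrak s)$$ is a Lie algebra and $[\mathfrak s,\mathfrak g]\subset\mathfrak g$ (the latter is automatic if $\mathfrak s\subset\mathfrak g$, for instance if $\mathfrak s$ is one of the $\mathfrak b_j$). There exist a complement $\mathfrak r$ of $\mathfrak b$ in $\mathfrak g$ and a subspace $\mathfrak s'\subset\mathfrak s$ such that $\Psi:=\Pi_{\mathfrak r}\circ\mathrm{ad}_{b_\star}:\mathfrak s'\to\mathfrak r$ is an isomorphism, where $\Pi_{\mathfrak b},\Pi_{\mathfrak r}$ are the projections associated with $\mathfrak g=\mathfrak b\oplus\mathfrak r$. For every such choice, put $$s_\star=-\tfrac12\,\Psi^{-1}\Pi_{\mathfrak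 r}\Big(\sum_{1\le i<j\le m}[b_{\star,i},b_{\star,j}]\Big)\in\mathfrak s' .$$ Then there exist $t_0>0$ and an analytic map $t\in(-t_0,t_0)\mapsto(b_t,s_t)\in\mathfrak b\times\mathfrak s'$ with $b_0=b_\star$ and $$e^{tb_\star}=e^{-ts_t}e^{tb_{t,1}}\cdots e^{tb_{t,m}}e^{ts_t}\qquad\text{for all }t\in(-t_0,t_0).$$ Moreover, for every such $t_0$ and $(b_t,s_t)$ there exists $t_1\in(0,t_0)$ such that for all $t\in(-t_1,t_1)$ the sequence $(b_t^{(k)},s_t^{(k)})_{k\ge0}$ in $\mathfrak b\times\mathfrak s'$ given by $b_t^{(0)}=b_\star$, $s_t^{(0)}=s_\star$ and $$b_t^{(k+1)}=b_t^{(k)}+b_\star-\Pi_{\mathfrak b}\,g^{(k)},\qquad s_t^{(k+1)}=s_t^{(k)}-t^{-1}\Psi^{-1}\Pi_{\mathfrak r}\,g^{(k)},$$ $$g^{(k)}=t^{-1}\log\!\big(e^{-ts_t^{(k)}}e^{tb_{t,1}^{(k)}}\cdots e^{tb_{t,m}^{(k)}}e^{ts_t^{(k)}}\big)$$ is well defined: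 at each step the principal matrix logarithm exists (no eigenvalue of the product lies in $(-\infty,0]$) and $g^{(k)}\in\mathfrak g$. For $t=0$ the recursion is understood as its limit when $t\to0$, namely $b_0^{(k+1)}=b_\star$ and $s_0^{(k+1)}=s_0^{(k)}-\Psi^{-1}\Pi_{\mathfrak r}\big([b_0^{(k)},s_0^{(k)}]+\tfrac12\sum_{i<j}[b_{0,i}^{(k)},b_{0,j}^{(k)}]\big)$. Furthermore, there exists $C>0$, independent of $t$ and $k$, such that for all $t\in(-t_1,t_1)$ and all $k\ge0$, $$|b_t^{(k)}-b_t|+|s_t^{(k)}-s_t|\le C\,2^{-k}.$$ -/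

import Mathlib

/-- Real square matrices of size `n`, i.e. the Lie algebra `𝔤𝔩ₙ(ℝ)` with `⁅A, B⁆ = A * B - B * A`. -/
abbrev Mat (n : ℕ) : Type := Matrix (Fin n) (Fin n) ℝ

-- All norms on a finite-dimensional space are equivalent; the operator norm induced by the
-- sup norm is the one used for matrices below.
attribute [local instance] Matrix.linftyOpNormedAddCommGroup Matrix.linftyOpNormedSpace

namespace ExactSplitting

noncomputable section

/-! ### The principal matrix logarithm -/

/-- The domain of the principal logarithm: no complex eigenvalue of `P` lies on the closed
half-line of nonpositive real numbers. -/
def InLogDomain {n : ℕ} (P : Mat n) : Prop :=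
  spectrum ℂ (P.map (fun x : ℝ => (x : ℂ))) ⊆ Complex.slitPlane

/-- The principal logarithm of a real matrix `P` with `InLogDomain P`, computed entrywise as
`∫₀¹ (P - 1) (1 + τ (P - 1))⁻¹ dτ`. This is the holomorphic functional calculus of
`Log z = ∫₀¹ (z - 1) / (1 + τ (z - 1)) dτ`, which holds on the slit plane. -/
def matrixLog {n : ℕ} (P : Mat n) : Mat n :=
  Matrix.of fun i j => ∫ τ in (0 : ℝ)..1, ((P - 1) * (1 + τ • (P - 1))⁻¹) i j

/-! ### Projections associated with a direct sum `g = p ⊕ q` -/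

section Projections

variable {E : Type*} [AddCommGroup E] [Module ℝ E]

/-- The identification `p × q ≃ g`, `(x, y) ↦ x + y`, when `g = p ⊕ q`. -/
def sumEquiv {p q g : Submodule ℝ E} (hd : Disjoint p q) (hg : p ⊔ q = g) :
    (p × q) ≃ₗ[ℝ] g :=
  LinearEquiv.ofBijective
    (LinearMap.codRestrict g (LinearMap.coprod p.subtype q.subtype) (by
      rintro ⟨x, y⟩
      rw [← hg]
      exact Submodule.add_mem_sup x.2 y.2))
    (by
      constructor
      · rw [← LinearMap.ker_eq_bot, LinearMap.ker_eq_bot']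
        rintro ⟨x, y⟩ h
        have h' : (x : E) + y = 0 := congrArg Subtype.val h
        have hx : (x : E) ∈ q := by
          rw [eq_neg_of_add_eq_zero_left h']
          exact q.neg_mem y.2
        have hx0 : (x : E) = 0 := Submodule.disjoint_def.1 hd _ x.2 hx
        have hy0 : (y : E) = 0 := by simpa [hx0] using h'
        exact Prod.ext (Subtype.ext hx0) (Subtype.ext hy0)
      · rintro ⟨z, hz⟩
        rw [← hg] at hz
        obtain ⟨x, hx, y, hy, rfl⟩ := Submodule.mem_sup.1 hz
        exact ⟨(⟨x, hx⟩, ⟨y, hy⟩), rfl⟩)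

/-- The projection of `g = p ⊕ q` onto `p` along `q`. -/
def projLeft {p q g : Submodule ℝ E} (hd : Disjoint p q) (hg : p ⊔ q = g) : g →ₗ[ℝ] p :=
  LinearMap.fst ℝ p q ∘ₗ (sumEquiv hd hg).symm.toLinearMap

/-- The projection of `g = p ⊕ q` onto `q` along `p`. -/
def projRight {p q g : Submodule ℝ E} (hd : Disjoint p q) (hg : p ⊔ q = g) : g →ₗ[ℝ] q :=
  LinearMap.snd ℝ p q ∘ₗ (sumEquiv hd hg).symm.toLinearMap

end Projections

/-! ### The setting -/

/-- `ad_b : x ↦ [b, x]`. -/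
def ad {n : ℕ} (b : Mat n) : Mat n →ₗ[ℝ] Mat n :=
  LinearMap.mulLeft ℝ b - LinearMap.mulRight ℝ b

theorem ad_apply {n : ℕ} (b x : Mat n) : ad b x = ⁅b, x⁆ := rfl

/-- The space `𝔤 = (𝔟₁ + ⋯ + 𝔟ₘ) + ad_{b⋆}(𝔰)`. -/
def totalSpace {n m : ℕ} (𝔟 : Fin m → Submodule ℝ (Mat n)) (𝔰 : Submodule ℝ (Mat n))
    (b : Mat n) : Submodule ℝ (Mat n) :=
  (⨆ i, 𝔟 i) ⊔ 𝔰.map (ad b)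

/-- The given objects: subspaces `𝔟₁, …, 𝔟ₘ` in direct sum, a subspace `𝔰` and an element `b⋆` of
`𝔟 = 𝔟₁ ⊕ ⋯ ⊕ 𝔟ₘ`, such that `𝔤 = 𝔟 + ad_{b⋆}(𝔰)` is a Lie algebra and `[𝔰, 𝔤] ⊆ 𝔤`
(which is automatic if `𝔰 ⊆ 𝔤`). -/
structure Setting (n m : ℕ) where
  𝔟 : Fin m → Submodule ℝ (Mat n)
  𝔰 : Submodule ℝ (Mat n)
  indep : iSupIndep 𝔟
  bStar : ↥(⨆ i, 𝔟 i)
  isLie : ∀ x ∈ totalSpace 𝔟 𝔰 bStar, ∀ y ∈ totalSpace 𝔟 𝔰 bStar,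
    ⁅x, y⁆ ∈ totalSpace 𝔟 𝔰 bStar
  normalizes : ∀ s ∈ 𝔰, ∀ x ∈ totalSpace 𝔟 𝔰 bStar, ⁅s, x⁆ ∈ totalSpace 𝔟 𝔰 bStar

namespace Setting

variable {n m : ℕ} (S : Setting n m)

/-- `𝔟 = 𝔟₁ ⊕ ⋯ ⊕ 𝔟ₘ`. -/
abbrev bSum : Submodule ℝ (Mat n) := ⨆ i, S.𝔟 i

/-- `𝔤 = 𝔟 + ad_{b⋆}(𝔰)`. -/
abbrev 𝔤 : Submodule ℝ (Mat n) := totalSpace S.𝔟 S.𝔰 S.bStar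

/-- The identification of `𝔟` with the direct sum of the `𝔟ᵢ`, `(bᵢ)ᵢ ↦ b₁ + ⋯ + bₘ`. -/
def sumComp : (Π₀ i, S.𝔟 i) ≃ₗ[ℝ] S.bSum :=
  (LinearEquiv.ofInjective (DFinsupp.lsum ℕ fun i => (S.𝔟 i).subtype)
    S.indep.dfinsupp_lsum_injective).trans
    (LinearEquiv.ofEq _ _ (Submodule.iSup_eq_range_dfinsupp_lsum S.𝔟).symm)

/-- The component `bᵢ ∈ 𝔟ᵢ` of `b = b₁ + ⋯ + bₘ ∈ 𝔟`. -/
def comp (b : S.bSum) (i : Fin m) : S.𝔟 i := S.sumComp.symm b i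

/-- `∑_{i < j} [bᵢ, bⱼ]`. -/
def bracketSum (b : S.bSum) : Mat n :=
  ∑ i, ∑ j ∈ Finset.Ioi i, ⁅(S.comp b i : Mat n), (S.comp b j : Mat n)⁆

/-- `e^{-ts} e^{t b₁} ⋯ e^{t bₘ} e^{ts}`. -/
def splitProduct (t : ℝ) (b : S.bSum) (s : Mat n) : Mat n :=
  NormedSpace.exp (-(t • s)) *
    (List.ofFn fun i => NormedSpace.exp (t • (S.comp b i : Mat n))).prod *
    NormedSpace.exp (t • s)

theorem comp_mem (b : S.bSum) (i : Fin m) : (S.comp b i : Mat n) ∈ S.𝔤 :=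
  Submodule.mem_sup_left (Submodule.mem_iSup_of_mem i (S.comp b i).2)

theorem bracketSum_mem (b : S.bSum) : S.bracketSum b ∈ S.𝔤 :=
  Submodule.sum_mem _ fun i _ => Submodule.sum_mem _ fun j _ =>
    S.isLie _ (S.comp_mem b i) _ (S.comp_mem b j)

/-- `ad_{b⋆} : 𝔰 → 𝔤`. -/
def adStar : S.𝔰 →ₗ[ℝ] S.𝔤 :=
  LinearMap.codRestrict S.𝔤
    (ad (S.bStar : Mat n) ∘ₗ S.𝔰.subtype)
    (fun s => Submodule.mem_sup_right (Submodule.mem_map_of_mem s.2))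

/-- A choice of a complement `𝔯` of `𝔟` in `𝔤` and of a subspace `𝔰'` of `𝔰` such that
`Π_𝔯 ∘ ad_{b⋆}` is an isomorphism from `𝔰'` to `𝔯`. -/
structure Decomposition where
  𝔯 : Submodule ℝ (Mat n)
  disjoint : Disjoint S.bSum 𝔯
  sup_eq : S.bSum ⊔ 𝔯 = S.𝔤
  𝔰' : Submodule ℝ (Mat n)
  le : 𝔰' ≤ S.𝔰
  bijective : Function.Bijective
    (projRight disjoint sup_eq ∘ₗ S.adStar ∘ₗ Submodule.inclusion le)

namespace Decomposition

variable {S} (D : S.Decomposition)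

/-- `Π_𝔟 : 𝔤 → 𝔟`, the projection along `𝔯`. -/
def projB : S.𝔤 →ₗ[ℝ] S.bSum := projLeft D.disjoint D.sup_eq

/-- `Π_𝔯 : 𝔤 → 𝔯`, the projection along `𝔟`. -/
def projR : S.𝔤 →ₗ[ℝ] D.𝔯 := projRight D.disjoint D.sup_eq

/-- The isomorphism `Ψ = Π_𝔯 ∘ ad_{b⋆} : 𝔰' → 𝔯`. -/
def Ψ : D.𝔰' ≃ₗ[ℝ] D.𝔯 :=
  LinearEquiv.ofBijective (D.projR ∘ₗ S.adStar ∘ₗ Submodule.inclusion D.le) D.bijective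

/-- `s⋆ = -½ Ψ⁻¹ Π_𝔯 (∑_{i < j} [b⋆ᵢ, b⋆ⱼ])`. -/
def sStar : D.𝔰' :=
  -((1 / 2 : ℝ) • D.Ψ.symm (D.projR ⟨S.bracketSum S.bStar, S.bracketSum_mem S.bStar⟩))

/-- `t ↦ (b_t, s_t) ∈ 𝔟 × 𝔰'` is an exact splitting on `(-t₀, t₀)`: it is analytic, `b_0 = b⋆` and
`e^{t b⋆} = e^{-t s_t} e^{t b_{t,1}} ⋯ e^{t b_{t,m}} e^{t s_t}`. -/
structure IsExactSplitting (t₀ : ℝ) (b : ℝ → S.bSum) (s : ℝ → D.𝔰') : Prop where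
  analytic_b : AnalyticOnNhd ℝ b (Set.Ioo (-t₀) t₀)
  analytic_s : AnalyticOnNhd ℝ s (Set.Ioo (-t₀) t₀)
  initial : b 0 = S.bStar
  eq_exp : ∀ t ∈ Set.Ioo (-t₀) t₀,
    NormedSpace.exp (t • (S.bStar : Mat n)) = S.splitProduct t (b t) (s t)

/-- One step `(b, s) ↦ (b', s')` of the iteration at time `t ≠ 0`: the logarithm is defined,
`g = t⁻¹ log(e^{-ts} e^{t b₁} ⋯ e^{t bₘ} e^{ts})` belongs to `𝔤`,
`b' = b + b⋆ - Π_𝔟 g` and `s' = s - t⁻¹ Ψ⁻¹ Π_𝔯 g`. -/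
def IsStepAt (t : ℝ) (x y : S.bSum × D.𝔰') : Prop :=
  InLogDomain (S.splitProduct t x.1 x.2) ∧
  ∃ hg : t⁻¹ • matrixLog (S.splitProduct t x.1 x.2) ∈ S.𝔤,
    y.1 = x.1 + S.bStar - D.projB ⟨_, hg⟩ ∧
    y.2 = x.2 - t⁻¹ • D.Ψ.symm (D.projR ⟨_, hg⟩)

/-- The step at `t = 0`, where the formulas for `t ≠ 0` are extended by continuity: since
`g = b + t ([b, s] + ½ ∑_{i < j} [bᵢ, bⱼ]) + O(t²)` and `Π_𝔯 b = 0`, it reads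
`b' = b⋆` and `s' = s - Ψ⁻¹ Π_𝔯 ([b, s] + ½ ∑_{i < j} [bᵢ, bⱼ])`. -/
def IsStepZero (x y : S.bSum × D.𝔰') : Prop :=
  ∃ hg : ⁅(x.1 : Mat n), (x.2 : Mat n)⁆ + (1 / 2 : ℝ) • S.bracketSum x.1 ∈ S.𝔤,
    y.1 = S.bStar ∧
    y.2 = x.2 - D.Ψ.symm (D.projR ⟨_, hg⟩)

/-- `(b^{(k)}, s^{(k)})_k` is the sequence started at `(b⋆, s⋆)` and produced by the iteration. -/
structure IsIteration (t : ℝ) (x : ℕ → S.bSum × D.𝔰') : Prop where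
  initial : x 0 = (S.bStar, D.sStar)
  step : ∀ k, t ≠ 0 → D.IsStepAt t (x k) (x (k + 1))
  step_zero : ∀ k, t = 0 → D.IsStepZero (x k) (x (k + 1))

end Decomposition

end Setting

end

end ExactSplitting

/-! Write log(e^{-ts} e^{tb₁} ⋯ e^{tbₘ} e^{ts}) = t b + t² H(t, b, s). Here H is analytic near t =
0, with H(0, b, s) = [b, s] + ½ ∑_{i<j} [bᵢ, bⱼ] (`HasExpJet.exists_log_remainder`). It takes values
in 𝔤, by a local Baker–Campbell–Hausdorff theorem (`eventually_log_conj_prod_exp_mem`). Since Π_𝔟 b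
= b and Π_𝔯 b = 0, the powers t⁻¹ in the recursion cancel, and one step is the analytic map Φ(t, (b,
s)) = (b⋆ - t Π_𝔟 H, s - Ψ⁻¹ Π_𝔯 H), including at t = 0. For small t ≠ 0, its fixed points near a
given point are exactly the solutions of the splitting equation (`exists_isIterationMap`).

At t = 0 the first component of Φ is the constant b⋆. For b = b⋆ the second component is s⋆ whatever
s is, because Ψ⁻¹ Π_𝔯 [b⋆, s] = s. Hence the derivative K of Φ(0, ·) at (b⋆, s⋆) satisfies K² = 0.
So 1 - K is invertible with inverse 1 + K, and the inverse function theorem yields an analytic curve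
of fixed points (`exists_analyticAt_fixedPoint`). In an adapted norm K contracts by 1/4, so for
small t the map Φ(t, ·) contracts by 1/2 near (b⋆, s⋆), which gives the rate 2^{-k}
(`eventually_iterate_dist_le`).

An arbitrary exact splitting consists of fixed points for t ≠ 0. Letting t → 0 forces s_0 = s⋆, so
the contraction argument applies to it too (`isExactSplitting_fixed`). -/

namespace ExactSplitting

open Filter Topology NormedSpace

/-! ### Exponential and local logarithm in a Banach algebra. -/

section BanachAlgebra

variable {𝔸 : Type*} [NormedRing 𝔸] [NormedAlgebra ℝ 𝔸] [CompleteSpace 𝔸]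

/-- The entire function `z ↦ ∑ zᵏ / (k + 2)!`. -/
noncomputable def expRem (z : 𝔸) : 𝔸 :=
  FormalMultilinearSeries.ofScalarsSum (fun k : ℕ => ((k + 2).factorial : ℝ)⁻¹) z

theorem analyticAt_expRem (z : 𝔸) : AnalyticAt ℝ (expRem : 𝔸 → 𝔸) z := by
  have hr : (FormalMultilinearSeries.ofScalars 𝔸
      (fun k : ℕ => ((k + 2).factorial : ℝ)⁻¹)).radius = ⊤ := by
    apply FormalMultilinearSeries.ofScalars_radius_eq_top_of_tendsto
    · exact Eventually.of_forall fun k => by positivity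
    · have h : Tendsto (fun k : ℕ => (1 : ℝ) / ((k : ℝ) + 1)) atTop (𝓝 0) :=
        tendsto_one_div_add_atTop_nhds_zero_nat
      refine squeeze_zero (fun _ => by positivity) (fun k => ?_) h
      rw [norm_inv, norm_inv, Nat.succ_eq_add_one, show k + 1 + 2 = (k + 2) + 1 by ring,
        Nat.factorial_succ (k + 2)]
      have h0 : (0 : ℝ) < (k + 2).factorial := by positivity
      push_cast
      rw [norm_mul, Real.norm_of_nonneg h0.le, Real.norm_of_nonneg (by positivity)]
      rw [show (((k : ℝ) + 2 + 1) * (k + 2).factorial)⁻¹ / ((k + 2).factorial : ℝ)⁻¹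
        = 1 / ((k : ℝ) + 2 + 1) by field_simp]
      gcongr
      linarith
  have := (FormalMultilinearSeries.hasFPowerSeriesOnBall _
    (by rw [hr]; exact ENNReal.zero_lt_top) : HasFPowerSeriesOnBall _
      (FormalMultilinearSeries.ofScalars 𝔸
      (fun k : ℕ => ((k + 2).factorial : ℝ)⁻¹)) 0 _)
  rw [hr] at this
  exact this.analyticAt_of_mem (by simp)

omit [CompleteSpace 𝔸] in
theorem expRem_zero : expRem (0 : 𝔸) = (1 / 2 : ℝ) • 1 := by
  norm_num [expRem, Nat.factorial]

/-- Along z = t X the last term carries an explicit factor t² in front of an analytic function. This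
is how the remainders below stay analytic at t = 0 without dividing by t. -/
theorem exp_eq_one_add_add (z : 𝔸) : exp z = 1 + z + z * z * expRem z := by
  have hs : Summable fun k : ℕ => (k.factorial : ℝ)⁻¹ • z ^ k := expSeries_summable' z
  have h : Summable fun k : ℕ => ((k + 2).factorial : ℝ)⁻¹ • z ^ k := by
    refine Summable.of_norm_bounded_eventually_nat (g := fun k => ‖(k.factorial : ℝ)⁻¹ • z ^ k‖)
      (norm_expSeries_summable' z) (Eventually.of_forall fun k => ?_)
    rw [norm_smul, norm_smul]
    gcongr ?_ * _
    rw [Real.norm_of_nonneg (by positivity), Real.norm_of_nonneg (by positivity)]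
    gcongr
    linarith
  rw [congrFun (exp_eq_tsum ℝ) z, ← hs.sum_add_tsum_nat_add 2, expRem,
    FormalMultilinearSeries.ofScalars_sum_eq]
  congr 1
  · simp [Finset.sum_range_succ]
  · rw [← pow_two, ← h.tsum_mul_left]
    congr 1; ext k
    rw [mul_smul_comm, ← pow_add, add_comm 2 k]

variable (𝔸) in
/-- A local logarithm: an analytic local inverse of `exp`. -/
theorem exists_localLog : ∃ L : 𝔸 → 𝔸, AnalyticAt ℝ L 1 ∧ L 1 = 0 ∧
    (∀ᶠ P in 𝓝 (1 : 𝔸), exp (L P) = P) ∧ ∀ᶠ Z in 𝓝 (0 : 𝔸), L (exp Z) = Z := by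
  have hs : HasStrictFDerivAt (exp : 𝔸 → 𝔸) ((ContinuousLinearEquiv.refl ℝ 𝔸 : 𝔸 ≃L[ℝ] 𝔸) : 𝔸 →L[ℝ] 𝔸) 0 :=
    hasStrictFDerivAt_exp_zero
  have hc : ContDiffAt ℝ ⊤ (exp : 𝔸 → 𝔸) 0 := (exp_analytic (𝕂 := ℝ) (0 : 𝔸)).contDiffAt
  have h1 := hs.eventually_right_inverse
  have h2 := hs.eventually_left_inverse
  have h3 := hs.localInverse_apply_image
  have h4 := hc.to_localInverse hs.hasFDerivAt (by simp)
  rw [exp_zero] at h1 h3 h4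
  refine ⟨_, ?_, h3, h1, h2⟩
  exact h4.analyticAt

end BanachAlgebra
end ExactSplitting

namespace ExactSplitting

open Filter Topology NormedSpace

/-! ### Second order expansions in time. -/

section Jets

variable {𝔸 : Type*} [NormedRing 𝔸] [NormedAlgebra ℝ 𝔸] [CompleteSpace 𝔸]
  {E : Type*} [NormedAddCommGroup E] [NormedSpace ℝ E]

/-- `f (t, x) = exp (t a(x) + t² c(x) + O(t³))`, with an analytic second order remainder. -/
structure HasExpJet (f : ℝ × E → 𝔸) (a c : E → 𝔸) : Prop where
  analytic : ∀ x, AnalyticAt ℝ a x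
  exists_remainder : ∃ g : ℝ × E → 𝔸, (∀ x, AnalyticAt ℝ g (0, x)) ∧
    (∀ p, f p = 1 + p.1 • a p.2 + p.1 ^ 2 • g p) ∧
    ∀ x, g (0, x) = (1 / 2 : ℝ) • (a x * a x) + c x

theorem hasExpJet_exp {X : E → 𝔸} (hX : ∀ x, AnalyticAt ℝ X x) :
    HasExpJet (fun p : ℝ × E => NormedSpace.exp (p.1 • X p.2)) X 0 := by
  refine ⟨hX, fun p => X p.2 * X p.2 * expRem (p.1 • X p.2), fun x => ?_, fun p => ?_, fun x => ?_⟩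
  · have h1 : AnalyticAt ℝ (fun p : ℝ × E => X p.2) (0, x) :=
      (hX x).comp_of_eq analyticAt_snd rfl
    exact (h1.mul h1).mul ((analyticAt_expRem _).comp_of_eq (analyticAt_fst.smul h1) rfl)
  · rw [exp_eq_one_add_add]
    simp only [smul_mul_assoc, mul_smul_comm, smul_smul, pow_two]
  · simp [expRem_zero]

omit [CompleteSpace 𝔸] in
-- The product has second order term ½a² + ½a'² + aa', which exceeds ½(a + a')² by ½[a, a'].
theorem HasExpJet.mul {f f' : ℝ × E → 𝔸} {a c a' c' : E → 𝔸} (h : HasExpJet f a c)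
    (h' : HasExpJet f' a' c') :
    HasExpJet (fun p => f p * f' p) (fun x => a x + a' x)
      (fun x => c x + c' x + (1 / 2 : ℝ) • ⁅a x, a' x⁆) := by
  obtain ⟨ha, g, hg, hf, hc⟩ := h
  obtain ⟨ha', g', hg', hf', hc'⟩ := h'
  refine ⟨fun x => (ha x).add (ha' x), fun p => g p + g' p + a p.2 * a' p.2 +
    p.1 • (a p.2 * g' p + g p * a' p.2) + p.1 ^ 2 • (g p * g' p), fun x => ?_, fun p => ?_,
    fun x => ?_⟩
  · have h1 : AnalyticAt ℝ (fun p : ℝ × E => a p.2) (0, x) :=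
      (ha x).comp_of_eq analyticAt_snd rfl
    have h2 : AnalyticAt ℝ (fun p : ℝ × E => a' p.2) (0, x) :=
      (ha' x).comp_of_eq analyticAt_snd rfl
    have h3 : AnalyticAt ℝ (fun p : ℝ × E => p.1) (0, x) := analyticAt_fst
    exact ((((hg x).add (hg' x)).add (h1.mul h2)).add
      (h3.smul ((h1.mul (hg' x)).add ((hg x).mul h2)))).add
      ((h3.pow 2).smul ((hg x).mul (hg' x)))
  · rw [hf, hf']
    simp only [mul_add, add_mul, smul_mul_assoc, mul_smul_comm, smul_add, smul_smul, one_mul,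
      mul_one]
    module
  · simp only [hc, hc', Ring.lie_def, mul_add, add_mul]
    module

omit [CompleteSpace 𝔸] in
theorem HasExpJet.congr {f f' : ℝ × E → 𝔸} {a c a' c' : E → 𝔸} (h : HasExpJet f a c)
    (hf : ∀ p, f' p = f p) (ha : ∀ x, a' x = a x) (hc : ∀ x, c' x = c x) :
    HasExpJet f' a' c' := by
  rwa [funext hf, funext ha, funext hc]

theorem hasExpJet_prod {m : ℕ} {X : Fin m → E → 𝔸} (hX : ∀ i x, AnalyticAt ℝ (X i) x) :
    HasExpJet (fun p : ℝ × E => (List.ofFn fun i => NormedSpace.exp (p.1 • X i p.2)).prod)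
      (fun x => ∑ i, X i x)
      (fun x => (1 / 2 : ℝ) • ∑ i, ∑ j ∈ Finset.Ioi i, ⁅X i x, X j x⁆) := by
  induction m with
  | zero =>
    refine (hasExpJet_exp (X := fun _ : E => (0 : 𝔸)) fun _ => analyticAt_const).congr ?_ ?_ ?_ <;>
    simp
  | succ m ih =>
    refine ((hasExpJet_exp (hX 0)).mul (ih fun i => hX i.succ)).congr ?_ ?_ ?_
    · simp [List.ofFn_succ]
    · simp [Fin.sum_univ_succ]
    · intro x
      simp only [Fin.sum_univ_succ (n := m), Fin.sum_Ioi_zero, Fin.sum_Ioi_succ, Pi.zero_apply,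
        zero_add]
      rw [show ⁅X 0 x, ∑ i : Fin m, X i.succ x⁆ = ∑ i : Fin m, ⁅X 0 x, X i.succ x⁆ by
        simp only [Ring.lie_def, Finset.mul_sum, Finset.sum_mul, Finset.sum_sub_distrib]]
      module

/-- Second order expansion, with analytic remainder, of a local logarithm along a jet. -/
theorem HasExpJet.exists_log_remainder {f : ℝ × E → 𝔸} {a c : E → 𝔸} (h : HasExpJet f a c)
    {L : 𝔸 → 𝔸} (hL : AnalyticAt ℝ L 1) (hL1 : L 1 = 0) (hexp : ∀ᶠ P in 𝓝 (1 : 𝔸), exp (L P) = P) :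
    ∃ H : ℝ × E → 𝔸, ∀ x, AnalyticAt ℝ H (0, x) ∧ H (0, x) = c x ∧
      ∀ᶠ p in 𝓝 ((0 : ℝ), x), L (f p) = p.1 • a p.2 + p.1 ^ 2 • H p := by
  obtain ⟨ha, g, hg, hf, hc⟩ := h
  -- With Z the logarithm of 1 + tB, the equation exp Z = 1 + tB reads Z u = tB, where u = 1 at t =
  -- 0. Hence Z = t B u⁻¹, so Z² has an explicit factor t², and Z = tB - Z² `expRem Z` gives the
  -- remainder H.
  set B : ℝ × E → 𝔸 := fun p => a p.2 + p.1 • g p with hB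
  set Z : ℝ × E → 𝔸 := fun p => L (1 + p.1 • B p) with hZ
  set u : ℝ × E → 𝔸 := fun p => 1 + Z p * expRem (Z p) with hu
  have hBa : ∀ x, AnalyticAt ℝ B (0, x) := fun x =>
    ((ha x).comp_of_eq analyticAt_snd rfl).add (analyticAt_fst.smul (hg x))
  have h1a : ∀ x, AnalyticAt ℝ (fun p => 1 + p.1 • B p) ((0 : ℝ), x) := fun x =>
    analyticAt_const.add (analyticAt_fst.smul (hBa x))
  have hZa : ∀ x, AnalyticAt ℝ Z (0, x) := fun x => hL.comp_of_eq (h1a x) (by simp)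
  have hZ0 : ∀ x, Z (0, x) = 0 := fun x => by simp [hZ, hL1]
  have hra : ∀ x, AnalyticAt ℝ (fun p => expRem (Z p)) (0, x) := fun x =>
    (analyticAt_expRem _).comp_of_eq (hZa x) rfl
  have hua : ∀ x, AnalyticAt ℝ u (0, x) := fun x =>
    analyticAt_const.add ((hZa x).mul (hra x))
  have hu0 : ∀ x, u (0, x) = 1 := fun x => by simp [hu, hZ0]
  have hia : ∀ x, AnalyticAt ℝ (fun p => Ring.inverse (u p)) (0, x) := fun x =>
    (analyticAt_inverse (1 : 𝔸ˣ)).comp_of_eq (hua x) (by simp [hu0])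
  refine ⟨fun p => g p - (B p * Ring.inverse (u p)) * (B p * Ring.inverse (u p)) * expRem (Z p),
    fun x => ⟨?_, ?_, ?_⟩⟩
  · exact (hg x).sub ((((hBa x).mul (hia x)).mul ((hBa x).mul (hia x))).mul (hra x))
  · simp [hu0, hZ0, expRem_zero, hB, hc]
  · have e1 : ∀ᶠ p in 𝓝 ((0 : ℝ), x), exp (Z p) = 1 + p.1 • B p :=
      (h1a x).continuousAt.tendsto.eventually (by simpa using hexp)
    have e2 : ∀ᶠ p in 𝓝 ((0 : ℝ), x), IsUnit (u p) :=
      (hua x).continuousAt.tendsto.eventually (by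
        rw [hu0]
        exact (Units.isOpen.mem_nhds isUnit_one))
    filter_upwards [e1, e2] with p h1 h2
    have hfp : f p = 1 + p.1 • B p := by
      rw [hf, hB]; simp only [smul_add, smul_smul, pow_two, add_assoc]
    rw [hfp]
    change Z p = _
    rw [exp_eq_one_add_add, add_assoc, add_right_inj] at h1
    have h3 : Z p = p.1 • (B p * Ring.inverse (u p)) := by
      rw [← smul_mul_assoc, ← h1, show Z p + Z p * Z p * expRem (Z p) = Z p * u p by
        simp [hu, mul_add, mul_assoc], Ring.mul_inverse_cancel_right _ _ h2]
    have h4 : Z p = p.1 • B p - Z p * Z p * expRem (Z p) := by rw [← h1]; abel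
    have h5 : Z p * Z p = p.1 ^ 2 • ((B p * Ring.inverse (u p)) * (B p * Ring.inverse (u p))) := by
      rw [h3, smul_mul_smul_comm, pow_two]
    rw [h5] at h4
    refine h4.trans ?_
    simp only [hB, smul_mul_assoc, smul_sub, smul_add, smul_smul, pow_two]
    abel

end Jets
end ExactSplitting

namespace ExactSplitting

open Filter Topology NormedSpace

/-! ### Conjugation by exponentials and the derivative of `exp` on a Lie subalgebra. -/

section BCH

variable {𝔸 : Type*} [NormedRing 𝔸] [NormedAlgebra ℝ 𝔸] [CompleteSpace 𝔸]

theorem exp_mul_exp_neg (x : 𝔸) : exp x * exp (-x) = 1 := by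
  let _ : NormedAlgebra ℚ 𝔸 := NormedAlgebra.restrictScalars ℚ ℝ 𝔸
  rw [← exp_add_of_commute (Commute.neg_right (Commute.refl x)), add_neg_cancel, exp_zero]

theorem exp_neg_mul_exp (x : 𝔸) : exp (-x) * exp x = 1 := by
  simpa using exp_mul_exp_neg (-x)

theorem exp_neg_mul_mul_exp (s x : 𝔸) :
    exp (exp (-s) * x * exp s) = exp (-s) * exp x * exp s := by
  let _ : NormedAlgebra ℚ 𝔸 := NormedAlgebra.restrictScalars ℚ ℝ 𝔸
  exact exp_units_conj' ⟨exp s, exp (-s), exp_mul_exp_neg s, exp_neg_mul_exp s⟩ x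

theorem continuous_exp : Continuous (exp : 𝔸 → 𝔸) :=
  continuous_iff_continuousAt.2 fun x => (exp_analytic (𝕂 := ℝ) x).continuousAt

/-- Conjugation by `exp z` preserves a closed subspace `𝔤`, given as the kernel of `q`, that is
stable under `[z, ·]`. -/
theorem exp_neg_mul_mul_exp_mem {𝔤 : Submodule ℝ 𝔸} {q : 𝔸 →L[ℝ] 𝔸} (hq : ∀ x, q x = 0 ↔ x ∈ 𝔤)
    (hq' : ∀ x, x - q x ∈ 𝔤) {z v : 𝔸} (hz : ∀ x ∈ 𝔤, ⁅z, x⁆ ∈ 𝔤) (hv : v ∈ 𝔤) :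
    exp (-z) * v * exp z ∈ 𝔤 := by
  set w : ℝ → 𝔸 := fun σ => exp (σ • -z) * v * exp (σ • z) with hw
  have hd : ∀ σ, HasDerivAt w (-⁅z, w σ⁆) σ := fun σ => by
    convert! ((hasDerivAt_exp_smul_const' (-z) σ).mul_const v).mul
      (hasDerivAt_exp_smul_const z σ) using 1
    simp only [hw, Ring.lie_def]
    noncomm_ring
  have hdq : ∀ σ, HasDerivAt (fun σ => q (w σ)) (q (-⁅z, w σ⁆)) σ := fun σ =>
    q.hasFDerivAt.comp_hasDerivAt σ (hd σ)
  -- Grönwall argument: w - q w lies in 𝔤, which [z, ·] preserves, so q [z, w] = q [z, q w]. The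
  -- derivative of q w is thus bounded by a multiple of q w, which vanishes at σ = 0.
  have key := eq_zero_of_abs_deriv_le_mul_abs_self_of_eq_zero_right (a := 0) (b := 1)
    (K := ‖q‖ * (2 * ‖z‖)) (f := fun σ => q (w σ)) (f' := fun σ => q (-⁅z, w σ⁆))
    (fun σ _ => (hdq σ).continuousAt.continuousWithinAt)
    (fun σ _ => (hdq σ).hasDerivWithinAt) (by simpa [hw] using (hq v).2 hv) (fun σ _ => by
      have h1 : q (-⁅z, w σ⁆) = q (-⁅z, q (w σ)⁆) := by
        rw [← sub_eq_zero, ← map_sub, hq, show -⁅z, w σ⁆ - -⁅z, q (w σ)⁆ = -⁅z, w σ - q (w σ)⁆ by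
          simp only [Ring.lie_def, mul_sub, sub_mul]; abel]
        exact 𝔤.neg_mem (hz _ (hq' _))
      rw [h1, mul_assoc]
      refine (q.le_opNorm _).trans ?_
      gcongr
      rw [norm_neg, Ring.lie_def]
      refine (norm_sub_le _ _).trans ?_
      have h2 := norm_mul_le z (q (w σ))
      have h3 := norm_mul_le (q (w σ)) z
      linarith) 1 (by simp)
  rw [← hq]
  simpa [hw] using key

/-- The derivative of `exp`, left translated to the identity, preserves a closed Lie subalgebra. -/
theorem exp_neg_mul_fderiv_exp_mem {𝔤 : Submodule ℝ 𝔸} {q : 𝔸 →L[ℝ] 𝔸}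
    (hq : ∀ x, q x = 0 ↔ x ∈ 𝔤) (hq' : ∀ x, x - q x ∈ 𝔤) {z v : 𝔸} (hz : ∀ x ∈ 𝔤, ⁅z, x⁆ ∈ 𝔤)
    (hv : v ∈ 𝔤) : exp (-z) * fderiv ℝ exp z v ∈ 𝔤 := by
  -- The path σ ↦ e^{-σz}(e^{σ(z+hv)} - e^{σz}) goes from 0 to k h, with derivative h e^{-σz} v
  -- e^{σ(z+hv)} = h (F h σ + e^{-σz} v e^{σz}). The projection q kills the conjugate of v, and F h
  -- σ → 0 uniformly in σ as h → 0. Hence q (k h) = o(h), which replaces the integral formula for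
  -- the derivative of `exp`.
  set F : ℝ → ℝ → 𝔸 := fun h σ => exp (σ • -z) * v * (exp (σ • (z + h • v)) - exp (σ • z)) with hF
  set k : ℝ → 𝔸 := fun h => exp (-z) * (exp (z + h • v) - exp z) with hk
  have hconj : ∀ σ : ℝ, q (exp (σ • -z) * v * exp (σ • z)) = 0 := fun σ => by
    rw [hq, smul_neg]
    refine exp_neg_mul_mul_exp_mem hq hq' (fun x hx => ?_) hv
    rw [Ring.lie_def, smul_mul_assoc, mul_smul_comm, ← smul_sub]
    exact 𝔤.smul_mem _ (hz x hx)
  have hbound : ∀ ε : ℝ, 0 < ε → ∀ᶠ h in 𝓝 (0 : ℝ), ‖q (k h)‖ ≤ ε * ‖h‖ := by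
    intro ε hε
    have hc : Continuous fun y : ℝ × ℝ => q (F y.1 y.2) := by
      have := continuous_exp (𝔸 := 𝔸)
      fun_prop
    have hev : ∀ᶠ h in 𝓝 (0 : ℝ), ∀ σ ∈ Set.Icc (0 : ℝ) 1, ‖q (F h σ)‖ < ε := by
      refine isCompact_Icc.eventually_forall_of_forall_eventually fun σ _ => ?_
      refine hc.norm.continuousAt.eventually_lt continuousAt_const ?_
      simpa [hF] using hε
    filter_upwards [hev] with h hh
    have hd : ∀ σ : ℝ, HasDerivAt
        (fun σ : ℝ => q (exp (σ • -z) * (exp (σ • (z + h • v)) - exp (σ • z))))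
        (h • q (F h σ)) σ := fun σ => by
      have h1 := (hasDerivAt_exp_smul_const (-z) σ).mul
        ((hasDerivAt_exp_smul_const' (z + h • v) σ).sub (hasDerivAt_exp_smul_const' z σ))
      convert! q.hasFDerivAt.comp_hasDerivAt σ h1 using 1
      rw [← add_zero (h • q (F h σ)), ← smul_zero h, ← hconj σ, ← map_smul, ← map_smul, ← map_add]
      congr 1
      simp only [hF, Pi.sub_apply, mul_sub, mul_add, add_mul, smul_mul_assoc, mul_smul_comm,
        smul_sub, mul_assoc, neg_mul, mul_neg]
      abel
    have := norm_image_sub_le_of_norm_deriv_le_segment_01' (C := ε * ‖h‖)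
      (fun σ _ => (hd σ).hasDerivWithinAt) (fun σ hσ => by
        rw [norm_smul, mul_comm]
        gcongr
        exact (hh σ ⟨hσ.1, hσ.2.le⟩).le)
    simpa [hk] using this
  have hder : HasDerivAt (fun h => q (k h)) (q (exp (-z) * fderiv ℝ exp z v)) 0 := by
    have h1 : HasDerivAt (fun h : ℝ => z + h • v) v 0 := by
      simpa using ((hasDerivAt_id (0 : ℝ)).smul_const v).const_add z
    have h2 : HasFDerivAt (exp : 𝔸 → 𝔸) (fderiv ℝ exp z) (z + (0 : ℝ) • v) := by
      simpa using (exp_analytic (𝕂 := ℝ) z).differentiableAt.hasFDerivAt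
    exact q.hasFDerivAt.comp_hasDerivAt 0
      (((h2.comp_hasDerivAt 0 h1).sub_const (exp z)).const_mul (exp (-z)))
  have hder0 : HasDerivAt (fun h => q (k h)) 0 0 := by
    rw [hasDerivAt_iff_isLittleO, Asymptotics.isLittleO_iff]
    intro ε hε
    filter_upwards [hbound ε hε] with h hh
    simpa [hk] using hh
  rw [← hq]
  exact hder.unique hder0

end BCH
end ExactSplitting

namespace ExactSplitting

open Filter Topology NormedSpace

/-! ### The local Baker–Campbell–Hausdorff theorem. -/

section BCH

variable {𝔸 : Type*} [NormedRing 𝔸] [NormedAlgebra ℝ 𝔸] [CompleteSpace 𝔸]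

/-- The derivative of `exp` at `Z`, left translated to the identity. -/
noncomputable def leftExpDeriv (Z : 𝔸) : 𝔸 →L[ℝ] 𝔸 :=
  (ContinuousLinearMap.mul ℝ 𝔸 (exp (-Z))).comp (fderiv ℝ exp Z)

theorem contDiff_leftExpDeriv : ContDiff ℝ 1 (leftExpDeriv : 𝔸 → 𝔸 →L[ℝ] 𝔸) := by
  rw [contDiff_iff_contDiffAt]
  intro Z
  have h1 : ContDiffAt ℝ 1 (fun Z : 𝔸 => ContinuousLinearMap.mul ℝ 𝔸 (exp (-Z))) Z :=
    (ContinuousLinearMap.mul ℝ 𝔸).contDiff.contDiffAt.comp Z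
      ((exp_analytic (𝕂 := ℝ) (-Z)).contDiffAt.comp Z contDiff_neg.contDiffAt)
  exact h1.clm_comp (exp_analytic (𝕂 := ℝ) Z).fderiv.contDiffAt

theorem leftExpDeriv_zero : leftExpDeriv (0 : 𝔸) = 1 := by
  ext v
  simp [leftExpDeriv, (hasFDerivAt_exp_zero (𝕂 := ℝ) (𝔸 := 𝔸)).fderiv]

/-- If `exp Z(τ) = exp X exp (τ Y)` then `Z' = (leftExpDeriv Z)⁻¹ Y`. -/
theorem leftExpDeriv_deriv_eq {X Y Z' : 𝔸} {Z : ℝ → 𝔸} {τ : ℝ} (hZ : HasDerivAt Z Z' τ)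
    (h : ∀ᶠ σ in 𝓝 τ, exp (Z σ) = exp X * exp (σ • Y)) : leftExpDeriv (Z τ) Z' = Y := by
  have h1 : HasDerivAt (fun σ => exp (Z σ)) (fderiv ℝ exp (Z τ) Z') τ :=
    (exp_analytic (𝕂 := ℝ) (Z τ)).differentiableAt.hasFDerivAt.comp_hasDerivAt τ hZ
  have h2 : HasDerivAt (fun σ => exp (Z σ)) (exp X * (exp (τ • Y) * Y)) τ :=
    ((hasDerivAt_exp_smul_const Y τ).const_mul (exp X)).congr_of_eventuallyEq h
  change exp (-(Z τ)) * fderiv ℝ exp (Z τ) Z' = Y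
  rw [h1.unique h2, ← mul_assoc (exp X), ← h.self_of_nhds, ← mul_assoc, exp_neg_mul_exp, one_mul]

/-- The quantitative core of the local Baker–Campbell–Hausdorff theorem: a path whose logarithmic
derivative lies in a Lie subalgebra `𝔤` moves transversally to `𝔤` at a rate at most proportional
to its distance to `𝔤`. -/
theorem norm_transversal_deriv_le {𝔤 : Submodule ℝ 𝔸} (hlie : ∀ x ∈ 𝔤, ∀ y ∈ 𝔤, ⁅x, y⁆ ∈ 𝔤)
    {q : 𝔸 →L[ℝ] 𝔸} (hq : ∀ x, q x = 0 ↔ x ∈ 𝔤) (hq' : ∀ x, x - q x ∈ 𝔤) {Y Z Z' : 𝔸} {K : ℝ}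
    (hY : Y ∈ 𝔤) (hZ : leftExpDeriv Z Z' = Y) (h1 : ‖leftExpDeriv Z - 1‖ ≤ 1 / 2)
    (h2 : ‖q‖ * ‖leftExpDeriv (Z - q Z) - 1‖ ≤ 1 / 2)
    (h3 : ‖leftExpDeriv Z - leftExpDeriv (Z - q Z)‖ ≤ K * ‖q Z‖) :
    ‖q Z'‖ ≤ (‖q‖ * K * (4 * ‖Y‖)) * ‖q Z‖ := by
  -- Comparison with the point Z - q Z of 𝔤, where the left translated derivative preserves 𝔤. The
  -- transversal part of Z' then has two sources: q Z' itself, whose contribution is at most ½ ‖q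
  -- Z'‖ and is absorbed, and the difference of the derivatives at Z and Z - q Z, which is O(‖q Z‖).
  -- The absorption turns the bound 2‖Y‖ on Z' into the factor 4‖Y‖.
  have hinv : ∀ v ∈ 𝔤, q (leftExpDeriv (Z - q Z) v) = 0 := fun v hv =>
    (hq _).2 (exp_neg_mul_fderiv_exp_mem hq hq' (hlie _ (hq' Z)) hv)
  have hqq : q (q Z') = q Z' := by
    have := (hq _).2 (hq' Z')
    rw [map_sub, sub_eq_zero] at this
    exact this.symm
  have hZ' : ‖Z'‖ ≤ 2 * ‖Y‖ := by
    have e : Z' = Y - (leftExpDeriv Z - 1) Z' := by simp [hZ]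
    have := (leftExpDeriv Z - 1).le_of_opNorm_le h1 Z'
    have h4 := norm_sub_le Y ((leftExpDeriv Z - 1) Z')
    rw [← e] at h4
    linarith
  have e : q Z' = -q ((leftExpDeriv (Z - q Z) - 1) (q Z')) -
      q ((leftExpDeriv Z - leftExpDeriv (Z - q Z)) Z') := by
    have e1 : q (leftExpDeriv Z Z') = 0 := by rw [hZ]; exact (hq _).2 hY
    have e2 := hinv _ (hq' Z')
    simp only [map_sub, sub_apply, one_apply_eq_self] at e2 ⊢
    rw [e1, hqq, sub_eq_zero.1 e2]
    abel
  have b1 : ‖q ((leftExpDeriv (Z - q Z) - 1) (q Z'))‖ ≤ 1 / 2 * ‖q Z'‖ := by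
    refine (q.le_opNorm _).trans ?_
    refine (mul_le_mul_of_nonneg_left (ContinuousLinearMap.le_opNorm _ _) (norm_nonneg _)).trans ?_
    rw [← mul_assoc]
    gcongr
  have b2 : ‖q ((leftExpDeriv Z - leftExpDeriv (Z - q Z)) Z')‖ ≤
      ‖q‖ * (K * ‖q Z‖ * (2 * ‖Y‖)) := by
    refine (q.le_opNorm _).trans ?_
    gcongr
    refine (ContinuousLinearMap.le_opNorm _ _).trans ?_
    exact mul_le_mul h3 hZ' (norm_nonneg _) ((norm_nonneg _).trans h3)
  have b3 := norm_sub_le (-q ((leftExpDeriv (Z - q Z) - 1) (q Z')))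
    (q ((leftExpDeriv Z - leftExpDeriv (Z - q Z)) Z'))
  rw [← e, norm_neg] at b3
  nlinarith

/-- Local Baker–Campbell–Hausdorff theorem: the logarithm of `exp X * exp Y` belongs to a Lie
subalgebra `𝔤` if `X, Y ∈ 𝔤` are small. -/
theorem eventually_log_exp_mul_exp_mem {𝔤 : Submodule ℝ 𝔸}
    (hlie : ∀ x ∈ 𝔤, ∀ y ∈ 𝔤, ⁅x, y⁆ ∈ 𝔤)
    {q : 𝔸 →L[ℝ] 𝔸} (hq : ∀ x, q x = 0 ↔ x ∈ 𝔤) (hq' : ∀ x, x - q x ∈ 𝔤)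
    {L : 𝔸 → 𝔸} (hL : AnalyticAt ℝ L 1) (hL1 : L 1 = 0)
    (hexp : ∀ᶠ P in 𝓝 (1 : 𝔸), exp (L P) = P) (hlog : ∀ᶠ Z in 𝓝 (0 : 𝔸), L (exp Z) = Z) :
    ∀ᶠ x : 𝔸 × 𝔸 in 𝓝 (0, 0), x.1 ∈ 𝔤 → x.2 ∈ 𝔤 → L (exp x.1 * exp x.2) ∈ 𝔤 := by
  have hce := continuous_exp (𝔸 := 𝔸)
  obtain ⟨K, T, hT, hK⟩ :=
    (contDiff_leftExpDeriv (𝔸 := 𝔸)).contDiffAt.exists_lipschitzOnWith (x := 0)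
  have hcΦ : Continuous (leftExpDeriv : 𝔸 → 𝔸 →L[ℝ] 𝔸) := contDiff_leftExpDeriv.continuous
  have hW : ∀ᶠ Z in 𝓝 (0 : 𝔸), Z ∈ T ∧ Z - q Z ∈ T ∧ ‖leftExpDeriv Z - 1‖ ≤ 1 / 2 ∧
      ‖q‖ * ‖leftExpDeriv (Z - q Z) - 1‖ ≤ 1 / 2 := by
    have c1 : Continuous fun Z : 𝔸 => Z - q Z := by fun_prop
    refine Filter.Eventually.and hT (.and ?_ (.and ?_ ?_))
    · exact c1.continuousAt.eventually_mem (by simpa using hT)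
    · have : Continuous fun Z : 𝔸 => ‖leftExpDeriv Z - 1‖ := by fun_prop
      refine (this.continuousAt.eventually_lt continuousAt_const ?_).mono fun _ h => h.le
      simp [leftExpDeriv_zero]
    · have : Continuous fun Z : 𝔸 => ‖q‖ * ‖leftExpDeriv (Z - q Z) - 1‖ := by fun_prop
      refine (this.continuousAt.eventually_lt continuousAt_const ?_).mono fun _ h => h.le
      simp [leftExpDeriv_zero]
  have hV : ∀ᶠ P in 𝓝 (1 : 𝔸), AnalyticAt ℝ L P ∧ (∀ᶠ P' in 𝓝 P, exp (L P') = P') ∧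
      (L P ∈ T ∧ L P - q (L P) ∈ T ∧ ‖leftExpDeriv (L P) - 1‖ ≤ 1 / 2 ∧
      ‖q‖ * ‖leftExpDeriv (L P - q (L P)) - 1‖ ≤ 1 / 2) :=
    hL.eventually_analyticAt.and (hexp.eventually_nhds.and
      (hL.continuousAt.tendsto.eventually (by rwa [hL1])))
  -- Compactness of [0, 1] makes all local conditions hold along the whole path τ ↦ e^X e^{τY}.
  have hpath : ∀ᶠ x : 𝔸 × 𝔸 in 𝓝 (0, 0), ∀ τ ∈ Set.Icc (0 : ℝ) 1,
      AnalyticAt ℝ L (exp x.1 * exp (τ • x.2)) ∧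
      (∀ᶠ P' in 𝓝 (exp x.1 * exp (τ • x.2)), exp (L P') = P') ∧
      (L (exp x.1 * exp (τ • x.2)) ∈ T ∧ L (exp x.1 * exp (τ • x.2)) -
        q (L (exp x.1 * exp (τ • x.2))) ∈ T ∧
        ‖leftExpDeriv (L (exp x.1 * exp (τ • x.2))) - 1‖ ≤ 1 / 2 ∧
        ‖q‖ * ‖leftExpDeriv (L (exp x.1 * exp (τ • x.2)) -
          q (L (exp x.1 * exp (τ • x.2)))) - 1‖ ≤ 1 / 2) := by
    refine isCompact_Icc.eventually_forall_of_forall_eventually fun τ _ => ?_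
    have : Continuous fun z : (𝔸 × 𝔸) × ℝ => exp z.1.1 * exp (z.2 • z.1.2) := by fun_prop
    have := this.tendsto ((0, 0), τ)
    simp only [smul_zero, exp_zero, mul_one] at this
    exact this.eventually hV
  have hX : ∀ᶠ x : 𝔸 × 𝔸 in 𝓝 (0, 0), L (exp x.1) = x.1 :=
    (continuous_fst.tendsto ((0, 0) : 𝔸 × 𝔸)).eventually hlog
  filter_upwards [hpath, hX] with x hx hx1 hx1m hx2m
  set P : ℝ → 𝔸 := fun τ => exp x.1 * exp (τ • x.2) with hP
  have hPd : ∀ τ, HasDerivAt P (exp x.1 * (exp (τ • x.2) * x.2)) τ := fun τ =>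
    (hasDerivAt_exp_smul_const x.2 τ).const_mul _
  have hLd : ∀ τ ∈ Set.Icc (0 : ℝ) 1, HasDerivAt (fun τ => L (P τ)) (deriv (fun τ => L (P τ)) τ) τ :=
    fun τ hτ => ((hx τ hτ).1.differentiableAt.comp τ (hPd τ).differentiableAt).hasDerivAt
  have hqd : ∀ τ ∈ Set.Icc (0 : ℝ) 1,
      HasDerivAt (fun τ => q (L (P τ))) (q (deriv (fun τ => L (P τ)) τ)) τ :=
    fun τ hτ => q.hasFDerivAt.comp_hasDerivAt τ (hLd τ hτ)
  -- Grönwall again: the transversal part of the logarithm starts at q X = 0 and grows at most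
  -- proportionally to itself.
  have key := eq_zero_of_abs_deriv_le_mul_abs_self_of_eq_zero_right (a := 0) (b := 1)
    (K := ‖q‖ * K * (4 * ‖x.2‖)) (f := fun τ => q (L (P τ)))
    (f' := fun τ => q (deriv (fun τ => L (P τ)) τ))
    (fun τ hτ => (hqd τ hτ).continuousAt.continuousWithinAt)
    (fun τ hτ => (hqd τ ⟨hτ.1, hτ.2.le⟩).hasDerivWithinAt)
    (by simpa [hP, hx1] using (hq _).2 hx1m) (fun τ hτ => by
      obtain ⟨-, h2, h3, h4, h5, h6⟩ := hx τ ⟨hτ.1, hτ.2.le⟩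
      refine norm_transversal_deriv_le hlie hq hq' hx2m
        (leftExpDeriv_deriv_eq (hLd τ ⟨hτ.1, hτ.2.le⟩) ((hPd τ).continuousAt.eventually h2))
        h5 h6 ?_
      have := hK.dist_le_mul _ h3 _ h4
      rwa [dist_eq_norm, dist_eq_norm, sub_sub_cancel] at this) 1 (by simp)
  rw [← hq]
  simpa [hP] using key

theorem continuous_prod_exp (m : ℕ) :
    Continuous fun X : Fin m → 𝔸 => (List.ofFn fun i => exp (X i)).prod := by
  have hce := continuous_exp (𝔸 := 𝔸)
  induction m with
  | zero => simpa using continuous_const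
  | succ m ih =>
    simp only [List.ofFn_succ, List.prod_cons]
    exact (hce.comp (continuous_apply 0)).mul
      (ih.comp (continuous_pi fun i => continuous_apply i.succ))

/-- Induction on the number of factors: the two-factor theorem is applied to the first exponent and
to the logarithm of the remaining product. -/
theorem eventually_log_prod_exp_mem {𝔤 : Submodule ℝ 𝔸}
    (hlie : ∀ x ∈ 𝔤, ∀ y ∈ 𝔤, ⁅x, y⁆ ∈ 𝔤)
    {q : 𝔸 →L[ℝ] 𝔸} (hq : ∀ x, q x = 0 ↔ x ∈ 𝔤) (hq' : ∀ x, x - q x ∈ 𝔤)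
    {L : 𝔸 → 𝔸} (hL : AnalyticAt ℝ L 1) (hL1 : L 1 = 0)
    (hexp : ∀ᶠ P in 𝓝 (1 : 𝔸), exp (L P) = P) (hlog : ∀ᶠ Z in 𝓝 (0 : 𝔸), L (exp Z) = Z) (m : ℕ) :
    ∀ᶠ X : Fin m → 𝔸 in 𝓝 0, (∀ i, X i ∈ 𝔤) → L (List.ofFn fun i => exp (X i)).prod ∈ 𝔤 := by
  induction m with
  | zero => exact Eventually.of_forall fun X _ => by simp [hL1]
  | succ m ih =>
    have htail : Tendsto (fun (X : Fin (m + 1) → 𝔸) (i : Fin m) => X i.succ) (𝓝 0) (𝓝 0) :=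
      (continuous_pi fun i => continuous_apply i.succ).tendsto' _ _ rfl
    have hQ : Tendsto (fun X : Fin (m + 1) → 𝔸 => (List.ofFn fun i : Fin m => exp (X i.succ)).prod)
        (𝓝 0) (𝓝 1) :=
      ((continuous_prod_exp m).tendsto' 0 1 (by simp)).comp htail
    have hLQ : Tendsto (fun X : Fin (m + 1) → 𝔸 =>
        (X 0, L (List.ofFn fun i : Fin m => exp (X i.succ)).prod)) (𝓝 0) (𝓝 (0, 0)) := by
      refine Tendsto.prodMk_nhds ((continuous_apply 0).tendsto' _ _ rfl) ?_
      rw [← hL1]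
      exact hL.continuousAt.tendsto.comp hQ
    filter_upwards [htail.eventually ih, hQ.eventually hexp,
      hLQ.eventually (eventually_log_exp_mul_exp_mem hlie hq hq' hL hL1 hexp hlog)]
      with X h1 h2 h3 hX
    have := h3 (hX 0) (h1 fun i => hX i.succ)
    rwa [h2, ← List.prod_cons, ← List.ofFn_succ (f := fun i => exp (X i))] at this

/-- The conjugating element only normalizes 𝔤 and need not belong to it, so its exponentials cannot
be treated as further factors. Instead the logarithm of a conjugate is the conjugate of the
logarithm, and conjugation preserves 𝔤. -/
theorem eventually_log_conj_prod_exp_mem {𝔤 : Submodule ℝ 𝔸}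
    (hlie : ∀ x ∈ 𝔤, ∀ y ∈ 𝔤, ⁅x, y⁆ ∈ 𝔤)
    {q : 𝔸 →L[ℝ] 𝔸} (hq : ∀ x, q x = 0 ↔ x ∈ 𝔤) (hq' : ∀ x, x - q x ∈ 𝔤)
    {L : 𝔸 → 𝔸} (hL : AnalyticAt ℝ L 1) (hL1 : L 1 = 0)
    (hexp : ∀ᶠ P in 𝓝 (1 : 𝔸), exp (L P) = P) (hlog : ∀ᶠ Z in 𝓝 (0 : 𝔸), L (exp Z) = Z) (m : ℕ) :
    ∀ᶠ y : 𝔸 × (Fin m → 𝔸) in 𝓝 0, (∀ x ∈ 𝔤, ⁅y.1, x⁆ ∈ 𝔤) → (∀ i, y.2 i ∈ 𝔤) →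
      L (exp (-y.1) * (List.ofFn fun i => exp (y.2 i)).prod * exp y.1) ∈ 𝔤 := by
  have hce := continuous_exp (𝔸 := 𝔸)
  have hX : Tendsto (fun y : 𝔸 × (Fin m → 𝔸) => y.2) (𝓝 0) (𝓝 0) := continuous_snd.tendsto' _ _ rfl
  have hQ : Tendsto (fun y : 𝔸 × (Fin m → 𝔸) => (List.ofFn fun i => exp (y.2 i)).prod)
      (𝓝 0) (𝓝 1) := ((continuous_prod_exp m).tendsto' 0 1 (by simp)).comp hX
  have hLQ : Tendsto (fun y : 𝔸 × (Fin m → 𝔸) => exp (-y.1) *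
      L (List.ofFn fun i => exp (y.2 i)).prod * exp y.1) (𝓝 0) (𝓝 0) := by
    have h1 : Tendsto (fun y : 𝔸 × (Fin m → 𝔸) => exp (-y.1)) (𝓝 0) (𝓝 1) :=
      (hce.comp continuous_fst.neg).tendsto' _ _ (by simp)
    have h2 : Tendsto (fun y : 𝔸 × (Fin m → 𝔸) => exp y.1) (𝓝 0) (𝓝 1) :=
      (hce.comp continuous_fst).tendsto' _ _ (by simp)
    have h3 := hL.continuousAt.tendsto.comp hQ
    rw [hL1] at h3
    simpa using (h1.mul h3).mul h2
  filter_upwards [hX.eventually (eventually_log_prod_exp_mem hlie hq hq' hL hL1 hexp hlog m),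
    hQ.eventually hexp, hLQ.eventually hlog] with y h1 h2 h3 hy hyX
  rw [exp_neg_mul_mul_exp, h2] at h3
  rw [h3]
  exact exp_neg_mul_mul_exp_mem hq hq' hy (h1 hyX)

end BCH
end ExactSplitting

namespace ExactSplitting

open Filter Topology NormedSpace

/-! ### The integral formula for the logarithm. -/

section IntegralLogarithm

variable {𝔸 : Type*} [NormedRing 𝔸] [NormedAlgebra ℝ 𝔸] [CompleteSpace 𝔸]

theorem commute_ringInverse_right {M : Type*} [MonoidWithZero M] {a b : M} (h : Commute a b) :
    Commute a (Ring.inverse b) := by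
  by_cases hb : IsUnit b
  · obtain ⟨u, rfl⟩ := hb
    rw [Ring.inverse_unit]
    exact h.units_inv_right
  · rw [Ring.inverse_non_unit _ hb]
    exact Commute.zero_right a

/-- Chain rule for `exp` along a path of commuting elements. -/
theorem hasDerivAt_exp_of_commute {l : ℝ → 𝔸} {l' : 𝔸} {σ : ℝ} (hl : HasDerivAt l l' σ)
    (hc : ∀ᶠ σ' in 𝓝 σ, Commute (l σ) (l σ')) :
    HasDerivAt (fun σ => exp (l σ)) (exp (l σ) * l') σ := by
  let _ : NormedAlgebra ℚ 𝔸 := NormedAlgebra.restrictScalars ℚ ℝ 𝔸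
  -- By commutation exp(l σ') = exp(l σ) exp(l σ' - l σ), so only the derivative of `exp` at 0 is
  -- needed.
  have h1 : HasFDerivAt (exp : 𝔸 → 𝔸) (1 : 𝔸 →L[ℝ] 𝔸) (l σ - l σ) := by
    rw [sub_self]; exact hasFDerivAt_exp_zero
  have h2 := (h1.comp_hasDerivAt σ (hl.sub_const (l σ))).const_mul (exp (l σ))
  refine h2.congr_of_eventuallyEq ?_
  filter_upwards [hc] with σ' h
  rw [Function.comp_apply, ← exp_add_of_commute (h.sub_right (Commute.refl _)),
    add_sub_cancel]

/-- The integrand `(P - 1) (1 + τ (P - 1))⁻¹` of the logarithm. -/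
noncomputable def logIntegrand (P : 𝔸) (τ : ℝ) : 𝔸 := (P - 1) * Ring.inverse (1 + τ • (P - 1))

omit [CompleteSpace 𝔸] in
theorem commute_logIntegrand (P : 𝔸) (σ τ : ℝ) :
    Commute (logIntegrand P σ) (logIntegrand P τ) := by
  have h1 : ∀ τ : ℝ, Commute (P - 1) (1 + τ • (P - 1)) := fun τ =>
    (Commute.one_right _).add_right ((Commute.refl _).smul_right τ)
  have h2 : Commute (1 + σ • (P - 1)) (1 + τ • (P - 1)) :=
    (Commute.one_left _).add_left ((h1 τ).smul_left σ)
  exact ((Commute.refl _).mul_right (commute_ringInverse_right (h1 τ))).mul_left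
    ((commute_ringInverse_right (h1 σ)).symm.mul_right h2.ringInverse_ringInverse)

theorem continuousAt_logIntegrand {x : 𝔸 × ℝ} (h : IsUnit (1 + x.2 • (x.1 - 1))) :
    ContinuousAt (fun x : 𝔸 × ℝ => logIntegrand x.1 x.2) x := by
  obtain ⟨u, hu⟩ := h
  have h1 : ContinuousAt (fun x : 𝔸 × ℝ => 1 + x.2 • (x.1 - 1)) x := by fun_prop
  have h2 : ContinuousAt (Ring.inverse : 𝔸 → 𝔸) (1 + x.2 • (x.1 - 1)) := by
    rw [← hu]; exact NormedRing.inverse_continuousAt u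
  exact (continuous_fst.sub continuous_const).continuousAt.mul (ContinuousAt.comp (f := fun x : 𝔸 × ℝ => 1 + x.2 • (x.1 - 1)) h2 h1)

/-- If l(σ) is minus the integral from 0 to σ, then exp(l(σ)) (1 + σ(P - 1)) has zero derivative and
equals 1 at σ = 0; the value σ = 1 gives the claim. The interval [-1, 2] contains [0, 1] in its
interior, so that all derivatives there are two-sided. -/
theorem exp_integral_logIntegrand {P : 𝔸}
    (hP : ∀ τ ∈ Set.Icc (-1 : ℝ) 2, IsUnit (1 + τ • (P - 1))) :
    exp (∫ τ in (0 : ℝ)..1, logIntegrand P τ) = P := by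
  set f := logIntegrand P with hf
  have hcf : ∀ τ ∈ Set.Icc (-1 : ℝ) 2, ContinuousAt f τ := fun τ hτ =>
    (continuousAt_logIntegrand (x := (P, τ)) (hP τ hτ)).comp (by fun_prop)
  have hcon : ContinuousOn f (Set.Icc (-1 : ℝ) 2) := fun τ hτ => (hcf τ hτ).continuousWithinAt
  have hint : ∀ σ ∈ Set.Ioo (-1 : ℝ) 2, IntervalIntegrable f MeasureTheory.volume 0 σ := fun σ hσ =>
    (hcon.mono (Set.uIcc_subset_Icc (by norm_num) ⟨hσ.1.le, hσ.2.le⟩)).intervalIntegrable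
  have hcomm : ∀ c : 𝔸, (∀ τ, Commute c (f τ)) → ∀ σ ∈ Set.Ioo (-1 : ℝ) 2,
      Commute c (∫ τ in (0 : ℝ)..σ, f τ) := fun c hc σ hσ => by
    have h1 := (ContinuousLinearMap.mul ℝ 𝔸 c).intervalIntegral_comp_comm (hint σ hσ)
    have h2 := ((ContinuousLinearMap.mul ℝ 𝔸).flip c).intervalIntegral_comp_comm (hint σ hσ)
    simp only [ContinuousLinearMap.mul_apply', ContinuousLinearMap.flip_apply] at h1 h2
    rw [Commute, SemiconjBy, ← h1, ← h2]
    simp only [(hc _).eq]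
  set l : ℝ → 𝔸 := fun σ => -∫ τ in (0 : ℝ)..σ, f τ with hl
  have hld : ∀ σ ∈ Set.Ioo (-1 : ℝ) 2, HasDerivAt l (-f σ) σ := fun σ hσ =>
    (intervalIntegral.integral_hasDerivAt_right (hint σ hσ)
      ((hcon.mono Set.Ioo_subset_Icc_self).stronglyMeasurableAtFilter isOpen_Ioo σ hσ)
      (hcf σ (Set.Ioo_subset_Icc_self hσ))).neg
  have hed : ∀ σ ∈ Set.Ioo (-1 : ℝ) 2, HasDerivAt (fun σ => exp (l σ)) (exp (l σ) * -f σ) σ :=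
    fun σ hσ => hasDerivAt_exp_of_commute (hld σ hσ) (by
      filter_upwards [isOpen_Ioo.mem_nhds hσ] with σ' hσ'
      exact (hcomm _ (fun τ => (hcomm _ (fun τ' => commute_logIntegrand P τ τ') σ hσ).symm)
        σ' hσ').neg_left.neg_right)
  have hG : ∀ σ ∈ Set.Ioo (-1 : ℝ) 2,
      HasDerivAt (fun σ => exp (l σ) * (1 + σ • (P - 1))) 0 σ := fun σ hσ => by
    have h1 : HasDerivAt (fun σ : ℝ => 1 + σ • (P - 1)) (P - 1) σ := by
      simpa using ((hasDerivAt_id σ).smul_const (P - 1)).const_add 1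
    convert! (hed σ hσ).mul h1 using 1
    rw [mul_neg, neg_mul, mul_assoc, hf, logIntegrand,
      Ring.inverse_mul_cancel_right _ _ (hP σ (Set.Ioo_subset_Icc_self hσ)), neg_add_cancel]
  have hsub : ∀ σ ∈ Set.Icc (0 : ℝ) 1, σ ∈ Set.Ioo (-1 : ℝ) 2 := fun σ hσ =>
    ⟨by linarith [hσ.1], by linarith [hσ.2]⟩
  have key := constant_of_has_deriv_right_zero (a := 0) (b := 1)
    (fun σ hσ => (hG σ (hsub σ hσ)).continuousAt.continuousWithinAt)
    (fun σ hσ => (hG σ (hsub σ ⟨hσ.1, hσ.2.le⟩)).hasDerivWithinAt) 1 (by simp)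
  simp only [hl, one_smul, add_sub_cancel, intervalIntegral.integral_same, neg_zero, exp_zero,
    zero_smul, add_zero, mul_one] at key
  rw [← mul_one (exp _), ← key, ← mul_assoc, exp_mul_exp_neg, one_mul]

variable (𝔸) in
theorem eventually_isUnit_one_add_smul :
    ∀ᶠ P in 𝓝 (1 : 𝔸), ∀ τ ∈ Set.Icc (-1 : ℝ) 2, IsUnit (1 + τ • (P - 1)) := by
  refine isCompact_Icc.eventually_forall_of_forall_eventually fun τ _ => ?_
  have hc : Continuous fun x : 𝔸 × ℝ => 1 + x.2 • (x.1 - 1) := by fun_prop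
  exact hc.continuousAt.eventually_mem (Units.isOpen.mem_nhds (by simp))

variable (𝔸) in
theorem tendsto_integral_logIntegrand :
    Tendsto (fun P : 𝔸 => ∫ τ in (0 : ℝ)..1, logIntegrand P τ) (𝓝 1) (𝓝 0) := by
  rw [Metric.tendsto_nhds]
  intro ε hε
  have hev : ∀ᶠ P in 𝓝 (1 : 𝔸), ∀ τ ∈ Set.Icc (0 : ℝ) 1, ‖logIntegrand P τ‖ < ε / 2 := by
    refine isCompact_Icc.eventually_forall_of_forall_eventually fun τ _ => ?_
    refine (continuousAt_logIntegrand (x := ((1 : 𝔸), τ)) (by simp)).norm.eventually_lt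
      continuousAt_const ?_
    simpa [logIntegrand] using hε
  filter_upwards [hev] with P hP
  rw [dist_zero_right]
  have := intervalIntegral.norm_integral_le_of_norm_le_const (a := (0 : ℝ)) (b := 1)
    (f := logIntegrand P) (C := ε / 2) (fun τ hτ => by
      rw [Set.uIoc_of_le zero_le_one] at hτ
      exact (hP τ ⟨hτ.1.le, hτ.2⟩).le)
  norm_num at this
  linarith

/-- A local logarithm coincides near `1` with the integral formula. -/
theorem eventually_integral_logIntegrand_eq {L : 𝔸 → 𝔸}
    (hlog : ∀ᶠ Z in 𝓝 (0 : 𝔸), L (exp Z) = Z) :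
    ∀ᶠ P in 𝓝 (1 : 𝔸), ∫ τ in (0 : ℝ)..1, logIntegrand P τ = L P := by
  filter_upwards [eventually_isUnit_one_add_smul 𝔸,
    (tendsto_integral_logIntegrand 𝔸).eventually hlog] with P h1 h2
  rw [← h2, exp_integral_logIntegrand h1]

/-- Taking for φ the matrix entries identifies the entrywise integral of `matrixLog` with the
integral in the Banach algebra. -/
theorem map_integral_logIntegrand {P : 𝔸} (hP : ∀ τ ∈ Set.Icc (-1 : ℝ) 2, IsUnit (1 + τ • (P - 1)))
    (φ : 𝔸 →ₗ[ℝ] ℝ) (hφ : Continuous φ) :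
    φ (∫ τ in (0 : ℝ)..1, logIntegrand P τ) = ∫ τ in (0 : ℝ)..1, φ (logIntegrand P τ) := by
  refine (ContinuousLinearMap.intervalIntegral_comp_comm ⟨φ, hφ⟩
    (ContinuousOn.intervalIntegrable fun τ hτ => ContinuousAt.continuousWithinAt ?_)).symm
  rw [Set.uIcc_of_le zero_le_one] at hτ
  exact (continuousAt_logIntegrand (x := (P, τ))
    (hP τ ⟨by linarith [hτ.1], by linarith [hτ.2]⟩)).comp (by fun_prop)

end IntegralLogarithm

/-! ### The principal logarithm of matrices near the identity. -/

section MatrixLogarithm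

attribute [local instance] Matrix.linftyOpNormedRing Matrix.linftyOpNormedAlgebra

variable {n : ℕ}

/-- Eigenvalues of P at distance less than 1 from 1 have positive real part. The factor ‖1‖ in the
spectral bound is kept because it is 0, not 1, when n = 0. -/
theorem eventually_inLogDomain : ∀ᶠ P in 𝓝 (1 : Mat n), InLogDomain P := by
  have hc : Continuous fun P : Mat n =>
      ‖P.map (fun x : ℝ => (x : ℂ)) - 1‖ * ‖(1 : Matrix (Fin n) (Fin n) ℂ)‖ :=
    (((continuous_id.matrix_map Complex.continuous_ofReal).sub continuous_const).norm).mul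
      continuous_const
  have h : ∀ᶠ P in 𝓝 (1 : Mat n),
      ‖P.map (fun x : ℝ => (x : ℂ)) - 1‖ * ‖(1 : Matrix (Fin n) (Fin n) ℂ)‖ < 1 := by
    refine hc.continuousAt.eventually_lt continuousAt_const ?_
    rw [Matrix.map_one _ Complex.ofReal_zero Complex.ofReal_one]
    simp
  filter_upwards [h] with P hP z hz
  have h1 : z - 1 ∈ spectrum ℂ (P.map (fun x : ℝ => (x : ℂ)) - 1) := by
    have := spectrum.sub_singleton_eq (P.map (fun x : ℝ => (x : ℂ))) (1 : ℂ)
    rw [map_one] at this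
    rw [← this]
    exact Set.sub_mem_sub hz rfl
  have h2 := (spectrum.norm_le_norm_mul_of_mem h1).trans_lt hP
  left
  have h3 := (Complex.abs_re_le_norm (z - 1)).trans_lt h2
  rw [abs_lt] at h3
  simp only [Complex.sub_re, Complex.one_re] at h3
  linarith [h3.1]

theorem eventually_matrixLog_eq {L : Mat n → Mat n} (hlog : ∀ᶠ Z in 𝓝 (0 : Mat n), L (exp Z) = Z) :
    ∀ᶠ P in 𝓝 (1 : Mat n), matrixLog P = L P := by
  filter_upwards [eventually_isUnit_one_add_smul (Mat n),
    eventually_integral_logIntegrand_eq hlog] with P h1 h2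
  rw [← h2]
  ext i j
  have := map_integral_logIntegrand h1 (Matrix.entryLinearMap ℝ ℝ i j)
    (continuous_id.matrix_elem i j)
  simp only [Matrix.entryLinearMap_apply] at this
  rw [this, matrixLog, Matrix.of_apply]
  simp only [logIntegrand, Matrix.nonsing_inv_eq_ringInverse]

end MatrixLogarithm

end ExactSplitting

namespace ExactSplitting

open Filter Topology

/-! ### Fixed points and iteration of a map whose space derivative squares to zero. -/

section FixedPoint

variable {E : Type*} [NormedAddCommGroup E] [NormedSpace ℝ E] {Φ : ℝ × E → E} {x₀ : E}

/-- The derivative in the space variable at `(0, x₀)`. -/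
noncomputable def spaceDeriv (Φ : ℝ × E → E) (x₀ : E) : E →L[ℝ] E :=
  (fderiv ℝ Φ (0, x₀)).comp (ContinuousLinearMap.inr ℝ ℝ E)

/-- If the derivative in the space variable squares to zero, there is an analytic curve of fixed
points. -/
theorem exists_analyticAt_fixedPoint [CompleteSpace E] (hΦ : AnalyticAt ℝ Φ (0, x₀))
    (h0 : Φ (0, x₀) = x₀) (hK : ∀ d, spaceDeriv Φ x₀ (spaceDeriv Φ x₀ d) = 0) :
    ∃ y : ℝ → E, AnalyticAt ℝ y 0 ∧ y 0 = x₀ ∧ ∀ᶠ t in 𝓝 0, Φ (t, y t) = y t := by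
  set D := fderiv ℝ Φ (0, x₀) with hD
  have hKD : ∀ d, spaceDeriv Φ x₀ d = D (0, d) := fun d => by simp [spaceDeriv, hD]
  have hsplit : ∀ z : ℝ × E, D z = D (z.1, 0) + D (0, z.2) := fun z => by
    rw [← map_add]; simp
  simp only [hKD] at hK
  -- T is the derivative of (t, x) ↦ (t, x - Φ(t, x)). Since K² = 0, the inverse of 1 - K is 1 + K,
  -- which gives the explicit inverse S of T.
  let T : (ℝ × E) →L[ℝ] ℝ × E :=
    (ContinuousLinearMap.fst ℝ ℝ E).prod (ContinuousLinearMap.snd ℝ ℝ E - D)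
  let R : (ℝ × E) →L[ℝ] E := ContinuousLinearMap.snd ℝ ℝ E +
    (D.comp (ContinuousLinearMap.inl ℝ ℝ E)).comp (ContinuousLinearMap.fst ℝ ℝ E)
  let S : (ℝ × E) →L[ℝ] ℝ × E :=
    (ContinuousLinearMap.fst ℝ ℝ E).prod (R + (spaceDeriv Φ x₀).comp R)
  have hR : ∀ z, R z = z.2 + D (z.1, 0) := fun z => by simp [R]
  have hT : ∀ z, T z = (z.1, z.2 - D z) := fun z => rfl
  have hS : ∀ z, S z = (z.1, R z + D (0, R z)) := fun z => by
    rw [← hKD]; rfl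
  have h1 : Function.LeftInverse S T := fun z => by
    have e : R (T z) = z.2 - D (0, z.2) := by
      rw [hR, hT]
      dsimp only
      rw [hsplit z]
      abel
    have e2 : D (0, z.2 - D (0, z.2)) = D (0, z.2) := by
      have : ((0 : ℝ), z.2 - D (0, z.2)) = (0, z.2) - (0, D (0, z.2)) := by simp
      rw [this, map_sub, hK, sub_zero]
    rw [hS, e, e2, hT]; simp
  have h2 : Function.RightInverse S T := fun z => by
    have e : D (S z) = D (z.1, 0) + D (0, R z) := by
      rw [hsplit, hS]
      congr 1
      have : ((0 : ℝ), R z + D (0, R z)) = (0, R z) + (0, D (0, R z)) := by simp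
      rw [this, map_add, hK, add_zero]
    rw [hT, e, hS]
    ext
    · rfl
    · simp [hR]
  let e : (ℝ × E) ≃L[ℝ] ℝ × E := ContinuousLinearEquiv.equivOfInverse T S h1 h2
  have hf : AnalyticAt ℝ (fun p : ℝ × E => (p.1, p.2 - Φ p)) (0, x₀) :=
    analyticAt_fst.prod (analyticAt_snd.sub hΦ)
  have hs : HasStrictFDerivAt (fun p : ℝ × E => (p.1, p.2 - Φ p))
      (e : (ℝ × E) →L[ℝ] ℝ × E) (0, x₀) :=
    (hasStrictFDerivAt_fst).prodMk (hasStrictFDerivAt_snd.sub hΦ.hasStrictFDerivAt)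
  have hr := hs.eventually_right_inverse
  have hi := hs.localInverse_apply_image
  have ha := (hf.contDiffAt (n := ⊤)).to_localInverse hs.hasFDerivAt (by simp)
  rw [h0, sub_self] at hr hi ha
  set g := hs.localInverse (fun p : ℝ × E => (p.1, p.2 - Φ p)) e (0, x₀)
  have hg : AnalyticAt ℝ g (0, 0) := ha.analyticAt
  refine ⟨fun t => (g (t, 0)).2, ?_, congrArg Prod.snd hi, ?_⟩
  · have h3 : AnalyticAt ℝ (fun t : ℝ => g (t, 0)) 0 :=
      hg.comp_of_eq (analyticAt_id.prod analyticAt_const) rfl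
    exact analyticAt_snd.comp h3
  · have h3 : Tendsto (fun t : ℝ => (t, (0 : E))) (𝓝 0) (𝓝 (0, 0)) :=
      (continuous_id.prodMk continuous_const).tendsto' _ _ rfl
    filter_upwards [h3.eventually hr] with t ht
    have e1 : (g (t, 0)).1 = t := congrArg Prod.fst ht
    have e2 : (g (t, 0)).2 - Φ (g (t, 0)) = 0 := congrArg Prod.snd ht
    rw [sub_eq_zero] at e2
    nth_rw 1 [← e1]
    exact e2.symm

/-- If the derivative in the space variable squares to zero, the iterates of `x₀` remain in any
given neighborhood and converge geometrically, uniformly in the parameter. -/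
theorem eventually_iterate_dist_le (hΦ : HasStrictFDerivAt Φ (fderiv ℝ Φ (0, x₀)) (0, x₀))
    (hK : ∀ d, spaceDeriv Φ x₀ (spaceDeriv Φ x₀ d) = 0) {y : ℝ → E} (hy : ContinuousAt y 0)
    (hy0 : y 0 = x₀) (hfix : ∀ᶠ t in 𝓝 0, Φ (t, y t) = y t) {Q : ℝ × E → Prop}
    (hQ : ∀ᶠ p in 𝓝 ((0 : ℝ), x₀), Q p) :
    ∀ᶠ t in 𝓝 (0 : ℝ), ∀ k : ℕ, Q (t, (fun x => Φ (t, x))^[k] x₀) ∧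
      ‖(fun x => Φ (t, x))^[k] x₀ - y t‖ ≤ 1 / 2 ^ k := by
  set K := spaceDeriv Φ x₀ with hKdef
  -- Adapted norm: K² = 0 gives N(K d) = ‖K d‖ ≤ N(d)/4, even if K is large in the original norm.
  set N : E → ℝ := fun d => ‖d‖ + 4 * ‖K d‖ with hN
  have hNle : ∀ d, ‖d‖ ≤ N d := fun d => by
    simp only [hN]; linarith [norm_nonneg (K d)]
  have hNc : Continuous N := by fun_prop
  have hNadd : ∀ d d', N (d + d') ≤ N d + N d' := fun d d' => by
    simp only [hN, map_add]
    linarith [norm_add_le d d', norm_add_le (K d) (K d')]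
  have hNK : ∀ d, N (K d) ≤ N d / 4 := fun d => by
    simp only [hN, hK, norm_zero]
    linarith [norm_nonneg d]
  have hNop : ∀ d, N d ≤ (1 + 4 * ‖K‖) * ‖d‖ := fun d => by
    simp only [hN]
    linarith [K.le_opNorm d]
  -- This tolerance in strict differentiability makes the nonlinear error at most ‖x - x'‖/4 in the
  -- norm N. With the 1/4 from K, the contraction factor is 1/2.
  have hc : 0 < 1 / (4 * (1 + 4 * ‖K‖)) := by positivity
  have hst := hΦ.isLittleO.def hc
  rw [nhds_prod_eq] at hst
  obtain ⟨V, hV, hstr⟩ := mem_prod_self_iff.1 hst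
  obtain ⟨r, hr, hball⟩ := Metric.eventually_nhds_iff_ball.1 (Filter.Eventually.and hV hQ)
  have hcontr : ∀ t x x', (t, x) ∈ Metric.ball ((0 : ℝ), x₀) r →
      (t, x') ∈ Metric.ball ((0 : ℝ), x₀) r → N (Φ (t, x) - Φ (t, x')) ≤ N (x - x') / 2 := by
    intro t x x' hx hx'
    have h1 := hstr (Set.mk_mem_prod (hball _ hx).1 (hball _ hx').1)
    simp only [Set.mem_ofPred_eq, Prod.mk_sub_mk, sub_self] at h1
    have h2 : fderiv ℝ Φ (0, x₀) (0, x - x') = K (x - x') := by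
      simp [hKdef, spaceDeriv]
    rw [h2, Prod.norm_mk, norm_zero, max_eq_right (norm_nonneg _)] at h1
    have h3 := hNadd (K (x - x')) (Φ (t, x) - Φ (t, x') - K (x - x'))
    rw [add_sub_cancel] at h3
    have h4 : N (Φ (t, x) - Φ (t, x') - K (x - x')) ≤ ‖x - x'‖ / 4 := by
      refine (hNop _).trans ?_
      refine (mul_le_mul_of_nonneg_left h1 (by positivity)).trans_eq ?_
      field_simp
    linarith [hNK (x - x'), hNle (x - x')]
  -- The bound r keeps all iterates in the ball where the contraction holds; the bound 1 gives the
  -- constant 1 in the final estimate.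
  have hsmall : ∀ᶠ t in 𝓝 (0 : ℝ), N (x₀ - y t) + ‖y t - x₀‖ < min r 1 := by
    have hca : ContinuousAt (fun t => N (x₀ - y t) + ‖y t - x₀‖) 0 := by fun_prop
    refine hca.eventually_lt continuousAt_const ?_
    simpa [hy0, hN] using hr
  have ht : ∀ᶠ t in 𝓝 (0 : ℝ), ‖t‖ < r :=
    continuous_norm.continuousAt.eventually_lt continuousAt_const (by simpa using hr)
  filter_upwards [hsmall, ht, hfix] with t h1 h2 h3
  have hmem : ∀ x, ‖x - x₀‖ < r → (t, x) ∈ Metric.ball ((0 : ℝ), x₀) r := fun x hx => by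
    rw [mem_ball_iff_norm, Prod.mk_sub_mk, sub_zero, Prod.norm_mk]
    exact max_lt h2 hx
  have hN0 : 0 ≤ N (x₀ - y t) := (norm_nonneg _).trans (hNle _)
  have hy' : (t, y t) ∈ Metric.ball ((0 : ℝ), x₀) r :=
    hmem _ (by linarith [min_le_left r 1])
  have hin : ∀ x, N (x - y t) ≤ N (x₀ - y t) → (t, x) ∈ Metric.ball ((0 : ℝ), x₀) r := fun x hx =>
    hmem x (by
      have := norm_add_le (x - y t) (y t - x₀)
      rw [sub_add_sub_cancel] at this
      linarith [min_le_left r 1, hNle (x - y t)])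
  have hind : ∀ k : ℕ, N ((fun x => Φ (t, x))^[k] x₀ - y t) ≤ N (x₀ - y t) / 2 ^ k := by
    intro k
    induction k with
    | zero => simp
    | succ k ih =>
      have hle : N (x₀ - y t) / 2 ^ k ≤ N (x₀ - y t) :=
        div_le_self hN0 (one_le_pow₀ (by norm_num))
      have := hcontr t _ _ (hin _ (ih.trans hle)) hy'
      rw [h3] at this
      rw [Function.iterate_succ_apply', pow_succ, ← div_div]
      linarith
  intro k
  have hle : N (x₀ - y t) / 2 ^ k ≤ N (x₀ - y t) :=
    div_le_self hN0 (one_le_pow₀ (by norm_num))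
  refine ⟨(hball _ (hin _ ((hind k).trans hle))).2, (hNle _).trans ((hind k).trans ?_)⟩
  gcongr
  linarith [min_le_right r 1, norm_nonneg (y t - x₀)]

/-- The derivative in the space variable squares to zero if at time `0` the first component is
constant and the map is constant in the second variable at the base point. -/
theorem spaceDeriv_spaceDeriv_eq_zero {E₁ E₂ : Type*} [NormedAddCommGroup E₁] [NormedSpace ℝ E₁]
    [NormedAddCommGroup E₂] [NormedSpace ℝ E₂] {Φ : ℝ × (E₁ × E₂) → E₁ × E₂} {x₀ : E₁ × E₂}
    (hΦ : DifferentiableAt ℝ Φ (0, x₀)) (h1 : ∀ x, (Φ (0, x)).1 = x₀.1)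
    (h2 : ∀ s, Φ (0, (x₀.1, s)) = x₀) (d : E₁ × E₂) :
    spaceDeriv Φ x₀ (spaceDeriv Φ x₀ d) = 0 := by
  have hder : ∀ d, HasDerivAt (fun r : ℝ => Φ (0, x₀ + r • d)) (spaceDeriv Φ x₀ d) 0 := fun d => by
    have e1 : HasDerivAt (fun r : ℝ => ((0 : ℝ), x₀ + r • d)) (0, d) 0 := by
      refine (hasDerivAt_const _ _).prodMk ?_
      simpa using ((hasDerivAt_id (0 : ℝ)).smul_const d).const_add x₀
    have e2 : HasFDerivAt Φ (fderiv ℝ Φ (0, x₀)) (0, x₀ + (0 : ℝ) • d) := by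
      simpa using hΦ.hasFDerivAt
    exact e2.comp_hasDerivAt 0 e1
  have hfst : ∀ d, (spaceDeriv Φ x₀ d).1 = 0 := fun d => by
    have e1 := (hasFDerivAt_fst (𝕜 := ℝ)).comp_hasDerivAt 0 (hder d)
    have e2 : HasDerivAt (fun _ : ℝ => x₀.1) (0 : E₁) 0 := hasDerivAt_const _ _
    refine e1.unique (e2.congr_of_eventuallyEq (Eventually.of_forall fun r => ?_))
    exact h1 _
  have hsnd : ∀ s, spaceDeriv Φ x₀ (0, s) = 0 := fun s => by
    have e2 : HasDerivAt (fun _ : ℝ => x₀) (0 : E₁ × E₂) 0 := hasDerivAt_const _ _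
    refine (hder (0, s)).unique (e2.congr_of_eventuallyEq (Eventually.of_forall fun r => ?_))
    refine (congrArg (fun x => Φ (0, x)) ?_).trans (h2 (x₀.2 + r • s))
    ext <;> simp
  have : spaceDeriv Φ x₀ d = (0, (spaceDeriv Φ x₀ d).2) := Prod.ext (hfst d) rfl
  rw [this, hsnd]

end FixedPoint
end ExactSplitting

namespace ExactSplitting

open Filter Topology

/-! ### Projections and existence of a decomposition. -/

section LinearAlgebra

variable {V F : Type*} [NormedAddCommGroup V] [NormedSpace ℝ V] [FiniteDimensional ℝ V]
  [NormedAddCommGroup F] [NormedSpace ℝ F]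

/-- Π_𝔟 and Ψ⁻¹ Π_𝔯 live on 𝔤 only; extended to all matrices, they can be composed with analytic
matrix-valued maps before membership in 𝔤 is known. -/
theorem exists_clm_extend {p : Submodule ℝ V} (f : p →ₗ[ℝ] F) :
    ∃ φ : V →L[ℝ] F, ∀ x (hx : x ∈ p), φ x = f ⟨x, hx⟩ := by
  obtain ⟨φ, hφ⟩ := f.exists_extend
  exact ⟨LinearMap.toContinuousLinearMap φ, fun x hx => LinearMap.congr_fun hφ ⟨x, hx⟩⟩

/-- Every subspace is the kernel of `1 - p` with `p` a projection onto it. -/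
theorem exists_clm_ker_eq (p : Submodule ℝ V) :
    ∃ q : V →L[ℝ] V, (∀ x, q x = 0 ↔ x ∈ p) ∧ ∀ x, x - q x ∈ p := by
  obtain ⟨f, hf⟩ := p.subtype.exists_leftInverse_of_injective p.ker_subtype
  have hf' : ∀ x (hx : x ∈ p), f x = ⟨x, hx⟩ := fun x hx => LinearMap.congr_fun hf ⟨x, hx⟩
  refine ⟨LinearMap.toContinuousLinearMap (LinearMap.id - p.subtype ∘ₗ f), fun x => ?_, fun x => ?_⟩
  · simp only [LinearMap.coe_toContinuousLinearMap', LinearMap.sub_apply, LinearMap.id_apply,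
      LinearMap.comp_apply, Submodule.subtype_apply, sub_eq_zero]
    exact ⟨fun h => h ▸ (f x).2, fun h => by rw [hf' x h]⟩
  · simp

variable {E : Type*} [AddCommGroup E] [Module ℝ E] {p q g : Submodule ℝ E}

theorem coe_projLeft_add_coe_projRight (hd : Disjoint p q) (hg : p ⊔ q = g) (x : g) :
    (projLeft hd hg x : E) + projRight hd hg x = x :=
  congrArg Subtype.val ((sumEquiv hd hg).apply_symm_apply x)

theorem sumEquiv_symm_left (hd : Disjoint p q) (hg : p ⊔ q = g) (x : p) (hx : (x : E) ∈ g) :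
    (sumEquiv hd hg).symm ⟨x, hx⟩ = (x, 0) := by
  rw [LinearEquiv.symm_apply_eq]
  exact Subtype.ext (add_zero (x : E)).symm

theorem sumEquiv_symm_right (hd : Disjoint p q) (hg : p ⊔ q = g) (x : q) (hx : (x : E) ∈ g) :
    (sumEquiv hd hg).symm ⟨x, hx⟩ = (0, x) := by
  rw [LinearEquiv.symm_apply_eq]
  exact Subtype.ext (zero_add (x : E)).symm

end LinearAlgebra

namespace Setting

variable {n m : ℕ} (S : Setting n m)

/-- The component map `b ↦ bᵢ`, with values in the space of matrices. -/
noncomputable def compLinear (i : Fin m) : S.bSum →ₗ[ℝ] Mat n :=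
  (S.𝔟 i).subtype ∘ₗ DFinsupp.lapply i ∘ₗ S.sumComp.symm.toLinearMap

theorem sum_comp (b : S.bSum) : ∑ i, (S.comp b i : Mat n) = b := by
  conv_rhs => rw [← S.sumComp.apply_symm_apply b]
  simp only [sumComp, LinearEquiv.trans_apply, LinearEquiv.coe_ofEq_apply,
    LinearEquiv.ofInjective_apply, DFinsupp.lsum_apply_apply, DFinsupp.sumAddHom_apply]
  rw [DFinsupp.sum_eq_sum_fintype]
  · rfl
  · simp

/-- Take for 𝔰' a complement in 𝔰 of the elements that ad_{b⋆} sends into 𝔟, obtained by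
intersecting a complement in the space of matrices with 𝔰. With 𝔯 = ad_{b⋆}(𝔰'), the map Ψ is just
ad_{b⋆}. -/
theorem nonempty_decomposition : Nonempty S.Decomposition := by
  obtain ⟨Q, hQ⟩ := (S.𝔰 ⊓ S.bSum.comap (ad (S.bStar : Mat n))).exists_isCompl
  set 𝔰' : Submodule ℝ (Mat n) := Q ⊓ S.𝔰 with h𝔰'
  have hker : ∀ x ∈ 𝔰', ad (S.bStar : Mat n) x ∈ S.bSum → x = 0 := fun x hx hxb =>
    Submodule.disjoint_def.1 hQ.disjoint x ⟨hx.2, hxb⟩ hx.1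
  have hdec : ∀ x ∈ S.𝔰, ∃ y ∈ 𝔰', ad (S.bStar : Mat n) (x - y) ∈ S.bSum := by
    intro x hx
    have hx' : x ∈ (S.𝔰 ⊓ S.bSum.comap (ad (S.bStar : Mat n))) ⊔ Q := by
      rw [hQ.sup_eq_top]; trivial
    obtain ⟨u, hu, v, hv, rfl⟩ := Submodule.mem_sup.1 hx'
    refine ⟨v, ⟨hv, ?_⟩, ?_⟩
    · simpa using S.𝔰.sub_mem hx hu.1
    · simpa using hu.2
  have hdisj : Disjoint S.bSum (𝔰'.map (ad (S.bStar : Mat n))) := by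
    rw [Submodule.disjoint_def]
    rintro _ hx ⟨y, hy, rfl⟩
    rw [hker y hy hx, map_zero]
  have hsup : S.bSum ⊔ 𝔰'.map (ad (S.bStar : Mat n)) = S.𝔤 := by
    refine le_antisymm (sup_le_sup_left (Submodule.map_mono inf_le_right) _)
      (sup_le le_sup_left ?_)
    rintro _ ⟨x, hx, rfl⟩
    obtain ⟨y, hy, hxy⟩ := hdec x hx
    rw [← sub_add_cancel x y, map_add]
    exact Submodule.add_mem_sup hxy (Submodule.mem_map_of_mem hy)
  have hval : ∀ x : 𝔰', projRight hdisj hsup (S.adStar (Submodule.inclusion inf_le_right x)) =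
      ⟨ad (S.bStar : Mat n) x, Submodule.mem_map_of_mem x.2⟩ := fun x =>
    congrArg Prod.snd (sumEquiv_symm_right hdisj hsup
      ⟨ad (S.bStar : Mat n) x, Submodule.mem_map_of_mem x.2⟩ _)
  refine ⟨⟨𝔰'.map (ad (S.bStar : Mat n)), hdisj, hsup, 𝔰', inf_le_right, ?_, ?_⟩⟩
  · rw [← LinearMap.ker_eq_bot, LinearMap.ker_eq_bot']
    intro x hx
    have h0 : ad (S.bStar : Mat n) x = 0 := congrArg Subtype.val ((hval x).symm.trans hx)
    exact Subtype.ext (hker x x.2 (h0 ▸ S.bSum.zero_mem))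
  · rintro ⟨_, x, hx, rfl⟩
    exact ⟨⟨x, hx⟩, hval ⟨x, hx⟩⟩

namespace Decomposition

variable {S} (D : S.Decomposition)

theorem projB_coe (b : S.bSum) (h : (b : Mat n) ∈ S.𝔤) : D.projB ⟨b, h⟩ = b :=
  congrArg Prod.fst (sumEquiv_symm_left D.disjoint D.sup_eq b h)

theorem projR_coe (b : S.bSum) (h : (b : Mat n) ∈ S.𝔤) : D.projR ⟨b, h⟩ = 0 :=
  congrArg Prod.snd (sumEquiv_symm_left D.disjoint D.sup_eq b h)

theorem Ψ_symm_projR_lie (s : D.𝔰') (h : ⁅(S.bStar : Mat n), (s : Mat n)⁆ ∈ S.𝔤) :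
    D.Ψ.symm (D.projR ⟨_, h⟩) = s :=
  D.Ψ.symm_apply_apply s

theorem eq_projB_of_Ψ_symm_projR_eq_zero {x : S.𝔤} (h : D.Ψ.symm (D.projR x) = 0) :
    (D.projB x : Mat n) = x := by
  rw [LinearEquiv.map_eq_zero_iff] at h
  have := coe_projLeft_add_coe_projRight D.disjoint D.sup_eq x
  rw [show projRight D.disjoint D.sup_eq x = 0 from h, Submodule.coe_zero, add_zero]
    at this
  exact this

theorem lie_mem (x : S.bSum × D.𝔰') : ⁅(x.1 : Mat n), (x.2 : Mat n)⁆ ∈ S.𝔤 := by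
  have := S.𝔤.neg_mem (S.normalizes _ (D.le x.2.2) _ (Submodule.mem_sup_left x.1.2))
  rwa [Ring.lie_def, neg_sub] at this

end Decomposition

end Setting

end ExactSplitting

namespace ExactSplitting

open Filter Topology

/-! ### Expansion of the logarithm of the split product. -/

section Expansion

attribute [local instance] Matrix.linftyOpNormedRing Matrix.linftyOpNormedAlgebra

variable {n m : ℕ}

theorem eventually_matrixLog_exp : ∀ᶠ Z in 𝓝 (0 : Mat n), matrixLog (NormedSpace.exp Z) = Z := by
  obtain ⟨L, -, -, -, hlog⟩ := exists_localLog (Mat n)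
  have h : Tendsto (NormedSpace.exp : Mat n → Mat n) (𝓝 0) (𝓝 1) :=
    (continuous_exp (𝔸 := Mat n)).tendsto' 0 1 NormedSpace.exp_zero
  filter_upwards [h.eventually (eventually_matrixLog_eq hlog), hlog] with Z h1 h2
  exact h1.trans h2

variable {S : Setting n m} (D : S.Decomposition)

namespace Setting.Decomposition

theorem analyticAt_comp (i : Fin m) (x : S.bSum × D.𝔰') :
    AnalyticAt ℝ (fun x : S.bSum × D.𝔰' => (S.comp x.1 i : Mat n)) x :=
  ((LinearMap.toContinuousLinearMap (S.compLinear i)).analyticAt x.1).comp analyticAt_fst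

theorem analyticAt_coe (x : S.bSum × D.𝔰') :
    AnalyticAt ℝ (fun x : S.bSum × D.𝔰' => (x.2 : Mat n)) x :=
  (D.𝔰'.subtypeL.analyticAt x.2).comp analyticAt_snd

/-- The terms -s and s cancel at first order, and at second order ½[-s, b] + ½[b - s, s] = [b, s].
-/
theorem hasExpJet_splitProduct :
    HasExpJet (fun p : ℝ × (S.bSum × D.𝔰') => S.splitProduct p.1 p.2.1 p.2.2)
      (fun x => (x.1 : Mat n))
      (fun x => ⁅(x.1 : Mat n), (x.2 : Mat n)⁆ + (1 / 2 : ℝ) • S.bracketSum x.1) := by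
  refine (((hasExpJet_exp fun x => (D.analyticAt_coe x).neg).mul
    (hasExpJet_prod fun i x => D.analyticAt_comp i x)).mul
    (hasExpJet_exp D.analyticAt_coe)).congr ?_ ?_ ?_
  · intro p
    simp only [splitProduct, Pi.neg_apply, smul_neg]
    rfl
  · intro x
    simp only [S.sum_comp, Pi.neg_apply]
    abel
  · intro x
    simp only [S.sum_comp, Pi.neg_apply, Pi.zero_apply, Ring.lie_def, bracketSum, mul_add, add_mul,
      neg_mul, mul_neg]
    module

/-- The logarithm of the split product, expanded to second order in time with an analytic
remainder with values in `𝔤`. -/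
theorem exists_log_splitProduct_expansion :
    ∃ H : ℝ × (S.bSum × D.𝔰') → Mat n, ∀ x : S.bSum × D.𝔰', AnalyticAt ℝ H (0, x) ∧
      H (0, x) = ⁅(x.1 : Mat n), (x.2 : Mat n)⁆ + (1 / 2 : ℝ) • S.bracketSum x.1 ∧
      ∀ᶠ p in 𝓝 ((0 : ℝ), x), InLogDomain (S.splitProduct p.1 p.2.1 p.2.2) ∧
        matrixLog (S.splitProduct p.1 p.2.1 p.2.2) = p.1 • (p.2.1 : Mat n) + p.1 ^ 2 • H p ∧
        NormedSpace.exp (p.1 • (p.2.1 : Mat n) + p.1 ^ 2 • H p) =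
          S.splitProduct p.1 p.2.1 p.2.2 ∧
        H p ∈ S.𝔤 := by
  obtain ⟨L, hL, hL1, hexp, hlog⟩ := exists_localLog (Mat n)
  obtain ⟨q, hq, hq'⟩ := exists_clm_ker_eq S.𝔤
  obtain ⟨H, hH⟩ := D.hasExpJet_splitProduct.exists_log_remainder hL hL1 hexp
  refine ⟨H, fun x => ⟨(hH x).1, (hH x).2.1, ?_⟩⟩
  have hsmall : Tendsto (fun p : ℝ × (S.bSum × D.𝔰') =>
      (p.1 • (p.2.2 : Mat n), fun i => p.1 • (S.comp p.2.1 i : Mat n))) (𝓝 (0, x)) (𝓝 0) := by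
    have h1 : ContinuousAt (fun p : ℝ × (S.bSum × D.𝔰') => p.1 • (p.2.2 : Mat n)) (0, x) :=
      continuousAt_fst.smul
        (ContinuousAt.comp (g := fun x : S.bSum × D.𝔰' => (x.2 : Mat n)) (f := Prod.snd)
          (D.analyticAt_coe x).continuousAt continuousAt_snd)
    have h2 : ∀ i, ContinuousAt (fun p : ℝ × (S.bSum × D.𝔰') =>
        p.1 • (S.comp p.2.1 i : Mat n)) (0, x) := fun i =>
      continuousAt_fst.smul
        (ContinuousAt.comp (g := fun x : S.bSum × D.𝔰' => (S.comp x.1 i : Mat n)) (f := Prod.snd)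
          (D.analyticAt_comp i x).continuousAt continuousAt_snd)
    have h3 := h1.prodMk (continuousAt_pi.2 h2)
    have h4 := h3.tendsto
    simp only [zero_smul] at h4
    exact h4
  have hmem := hsmall.eventually
    (eventually_log_conj_prod_exp_mem S.isLie hq hq' hL hL1 hexp hlog m)
  have hone : Tendsto (fun p : ℝ × (S.bSum × D.𝔰') => S.splitProduct p.1 p.2.1 p.2.2)
      (𝓝 (0, x)) (𝓝 1) := by
    obtain ⟨ha, g, hg, hf, -⟩ := D.hasExpJet_splitProduct
    have h1 : ContinuousAt (fun p : ℝ × (S.bSum × D.𝔰') =>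
        1 + p.1 • (p.2.1 : Mat n) + p.1 ^ 2 • g p) (0, x) :=
      ((continuousAt_const.add (continuousAt_fst.smul
        (ContinuousAt.comp (g := fun x : S.bSum × D.𝔰' => (x.1 : Mat n)) (f := Prod.snd)
          (ha x).continuousAt continuousAt_snd)))).add
        ((continuousAt_fst.pow 2).smul (hg x).continuousAt)
    have h2 := h1.tendsto
    simp only [zero_smul, add_zero, ne_eq, OfNat.ofNat_ne_zero, not_false_eq_true, zero_pow] at h2
    exact h2.congr fun p => (hf p).symm
  filter_upwards [hmem, hone.eventually eventually_inLogDomain,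
    hone.eventually (eventually_matrixLog_eq hlog), hone.eventually hexp, (hH x).2.2]
    with p h1 h2 h3 h4 h5
  refine ⟨h2, h3.trans h5, ?_, ?_⟩
  · rw [← h5]; exact h4
  -- The Baker–Campbell–Hausdorff argument yields t² H ∈ 𝔤, which says nothing at t = 0; there the
  -- explicit value of H is used.
  · by_cases hp : p.1 = 0
    · have : p = (0, p.2) := Prod.ext hp rfl
      rw [this, (hH p.2).2.1]
      exact S.𝔤.add_mem (D.lie_mem p.2) (S.𝔤.smul_mem _ (S.bracketSum_mem _))
    · have h6 : L (S.splitProduct p.1 p.2.1 p.2.2) ∈ S.𝔤 := by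
        refine h1 (fun y hy => ?_) fun i => S.𝔤.smul_mem _ (S.comp_mem _ i)
        have := S.𝔤.smul_mem p.1 (S.normalizes _ (D.le p.2.2.2) y hy)
        simpa only [Ring.lie_def, smul_mul_assoc, mul_smul_comm, ← smul_sub] using this
      have h7 : p.1 ^ 2 • H p ∈ S.𝔤 := by
        have := S.𝔤.sub_mem h6
          (S.𝔤.smul_mem p.1 (Submodule.mem_sup_left p.2.1.2 : (p.2.1 : Mat n) ∈ S.𝔤))
        rw [h5] at this
        simpa using this
      exact (S.𝔤.smul_mem_iff (pow_ne_zero 2 hp)).1 h7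

end Setting.Decomposition

end Expansion

end ExactSplitting

namespace ExactSplitting

open Filter Topology

/-! ### The iteration map, exact splittings and convergence. -/

namespace Setting.Decomposition

variable {n m : ℕ} {S : Setting n m} (D : S.Decomposition)

/-- One step of the iteration, at any time. -/
def IsStep (t : ℝ) (x y : S.bSum × D.𝔰') : Prop :=
  (t ≠ 0 → D.IsStepAt t x y) ∧ (t = 0 → D.IsStepZero x y)

/-- An analytic map `Φ` describing the iteration near a point, together with its relation to exact
splittings. -/
structure IsIterationMap (Φ : ℝ × (S.bSum × D.𝔰') → S.bSum × D.𝔰') : Prop where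
  analyticAt : ∀ x, AnalyticAt ℝ Φ (0, x)
  zero : ∀ x, ∃ h, Φ (0, x) = (S.bStar, x.2 - D.Ψ.symm (D.projR
    ⟨⁅(x.1 : Mat n), (x.2 : Mat n)⁆ + (1 / 2 : ℝ) • S.bracketSum x.1, h⟩))
  isStep_iff : ∀ x, ∀ᶠ p in 𝓝 ((0 : ℝ), x), ∀ y, D.IsStep p.1 p.2 y ↔ y = Φ p
  fixed : ∀ x, ∀ᶠ p in 𝓝 ((0 : ℝ), x), p.1 ≠ 0 → (Φ p = p.2 ↔
    NormedSpace.exp (p.1 • (S.bStar : Mat n)) = S.splitProduct p.1 p.2.1 p.2.2)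

/-- For t ≠ 0 one has g = b + t H with H ∈ 𝔤. Then b + b⋆ - Π_𝔟 g = b⋆ - t Π_𝔟 H and t⁻¹ Ψ⁻¹ Π_𝔯 g =
Ψ⁻¹ Π_𝔯 H, both analytic across t = 0. -/
theorem exists_isIterationMap : ∃ Φ, D.IsIterationMap Φ := by
  obtain ⟨H, hH⟩ := D.exists_log_splitProduct_expansion
  obtain ⟨π, hπ⟩ := exists_clm_extend D.projB
  obtain ⟨ρ, hρ⟩ := exists_clm_extend (D.Ψ.symm.toLinearMap ∘ₗ D.projR)
  have hb : ∀ b : S.bSum, (b : Mat n) ∈ S.𝔤 := fun b => Submodule.mem_sup_left b.2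
  have hπb : ∀ b : S.bSum, π b = b := fun b => by rw [hπ _ (hb b), D.projB_coe]
  have hρb : ∀ b : S.bSum, ρ b = 0 := fun b => by
    rw [hρ _ (hb b), LinearMap.comp_apply, D.projR_coe, map_zero]
  have hc : ∀ x : S.bSum × D.𝔰',
      ⁅(x.1 : Mat n), (x.2 : Mat n)⁆ + (1 / 2 : ℝ) • S.bracketSum x.1 ∈ S.𝔤 := fun x =>
    S.𝔤.add_mem (D.lie_mem x) (S.𝔤.smul_mem _ (S.bracketSum_mem _))
  set Φ : ℝ × (S.bSum × D.𝔰') → S.bSum × D.𝔰' := fun p =>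
    (S.bStar - p.1 • π (H p), p.2.2 - ρ (H p)) with hΦ
  have hzero : ∀ x, Φ (0, x) = (S.bStar, x.2 - D.Ψ.symm (D.projR ⟨_, hc x⟩)) := fun x => by
    simp only [hΦ, zero_smul, sub_zero]
    rw [(hH x).2.1, hρ _ (hc x)]
    rfl
  refine ⟨Φ, ⟨fun x => ?_, fun x => ⟨hc x, hzero x⟩, fun x => ?_, fun x => ?_⟩⟩
  · have h1 := (hH x).1
    have h2 : AnalyticAt ℝ (fun p : ℝ × (S.bSum × D.𝔰') => p.2.2) (0, x) :=
      analyticAt_snd.comp analyticAt_snd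
    exact (analyticAt_const.sub (analyticAt_fst.smul ((π.analyticAt _).comp h1))).prod
      (h2.sub ((ρ.analyticAt _).comp h1))
  · filter_upwards [(hH x).2.2] with p ⟨h1, h2, h3, h4⟩ y
    by_cases hp : p.1 = 0
    · have hp' : p = (0, p.2) := Prod.ext hp rfl
      rw [hp', hzero]
      constructor
      · rintro ⟨-, h⟩
        obtain ⟨_, e1, e2⟩ := h rfl
        exact Prod.ext e1 e2
      · rintro rfl
        exact ⟨fun h => absurd rfl h, fun _ => ⟨hc p.2, rfl, rfl⟩⟩
    · have hg : p.1⁻¹ • matrixLog (S.splitProduct p.1 p.2.1 p.2.2) =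
          (p.2.1 : Mat n) + p.1 • H p := by
        rw [h2, smul_add, smul_smul, smul_smul, inv_mul_cancel₀ hp, one_smul, pow_two,
          inv_mul_cancel_left₀ hp]
      have hg' : p.1⁻¹ • matrixLog (S.splitProduct p.1 p.2.1 p.2.2) ∈ S.𝔤 := by
        rw [hg]; exact S.𝔤.add_mem (hb _) (S.𝔤.smul_mem _ h4)
      have e1 : p.2.1 + S.bStar - D.projB ⟨_, hg'⟩ = (Φ p).1 := by
        rw [← hπ _ hg', hg, map_add, hπb, map_smul]
        simp only [hΦ]
        abel
      have e2 : p.2.2 - p.1⁻¹ • D.Ψ.symm (D.projR ⟨_, hg'⟩) = (Φ p).2 := by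
        have : D.Ψ.symm (D.projR ⟨_, hg'⟩) = p.1 • ρ (H p) := by
          rw [← map_smul, ← zero_add (ρ _), ← hρb p.2.1, ← map_add, ← hg, hρ _ hg']
          rfl
        rw [this, smul_smul, inv_mul_cancel₀ hp, one_smul]
      constructor
      · rintro ⟨h, -⟩
        obtain ⟨-, _, f1, f2⟩ := h hp
        exact Prod.ext (f1.trans e1) (f2.trans e2)
      · rintro rfl
        exact ⟨fun _ => ⟨h1, hg', e1.symm, e2.symm⟩, fun h => absurd h hp⟩
  · have hlog : ∀ᶠ p : ℝ × (S.bSum × D.𝔰') in 𝓝 ((0 : ℝ), x),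
        matrixLog (NormedSpace.exp (p.1 • (S.bStar : Mat n))) = p.1 • (S.bStar : Mat n) := by
      have hc : Continuous fun p : ℝ × (S.bSum × D.𝔰') => p.1 • (S.bStar : Mat n) :=
        continuous_fst.smul continuous_const
      exact (hc.tendsto' (0, x) 0 (zero_smul _ _)).eventually eventually_matrixLog_exp
    filter_upwards [(hH x).2.2, hlog] with p ⟨_, h2, h3, h4⟩ h5 hp
    constructor
    -- At a fixed point Π_𝔯 H = 0, so H = Π_𝔟 H and b = b⋆ - t H; the exponent t b + t² H is then t
    -- b⋆.
    · intro h
      have f1 : S.bStar - p.1 • π (H p) = p.2.1 := congrArg Prod.fst h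
      have f2 : p.2.2 - ρ (H p) = p.2.2 := congrArg Prod.snd h
      have f3 : (π (H p) : Mat n) = H p := by
        rw [hπ _ h4]
        refine D.eq_projB_of_Ψ_symm_projR_eq_zero ?_
        have : ρ (H p) = 0 := by simpa using f2
        rwa [hρ _ h4] at this
      rw [← h3, ← f1]
      congr 1
      rw [Submodule.coe_sub, Submodule.coe_smul, f3, smul_sub, smul_smul, pow_two, sub_add_cancel]
    -- Conversely, equal exponentials have equal principal logarithms, so t H = b⋆ - b lies in 𝔟 and
    -- its 𝔯-component vanishes.
    · intro h
      rw [h, h2] at h5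
      have h6 : p.1 • H p = (S.bStar - p.2.1 : S.bSum) := by
        have : p.1 • ((p.2.1 : Mat n) + p.1 • H p) = p.1 • (S.bStar : Mat n) := by
          rw [← h5, smul_add, smul_smul, pow_two]
        rw [Submodule.coe_sub, ← smul_right_injective _ hp this, add_sub_cancel_left]
      have h7 : p.1 • π (H p) = S.bStar - p.2.1 := by rw [← map_smul, h6, hπb]
      have h8 : ρ (H p) = 0 := by
        have : p.1 • ρ (H p) = 0 := by rw [← map_smul, h6, hρb]
        exact (smul_eq_zero.1 this).resolve_left hp
      simp only [hΦ, h7, h8]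
      ext <;> simp

/-- The term Ψ⁻¹ Π_𝔯 [b⋆, s] = s cancels s, and what remains is the definition of s⋆. This
independence of s is what makes the space derivative square to zero. -/
theorem isIterationMap_zero_bStar {Φ : ℝ × (S.bSum × D.𝔰') → S.bSum × D.𝔰'}
    (hΦ : D.IsIterationMap Φ) (s : D.𝔰') : Φ (0, (S.bStar, s)) = (S.bStar, D.sStar) := by
  obtain ⟨h, e⟩ := hΦ.zero (S.bStar, s)
  rw [e]
  congr 1
  have : (⟨⁅(S.bStar : Mat n), (s : Mat n)⁆ + (1 / 2 : ℝ) • S.bracketSum S.bStar, h⟩ : S.𝔤) =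
      ⟨_, D.lie_mem (S.bStar, s)⟩ + (1 / 2 : ℝ) • ⟨_, S.bracketSum_mem S.bStar⟩ := rfl
  dsimp only
  rw [this, map_add, map_add, map_smul, map_smul, D.Ψ_symm_projR_lie, sStar]
  abel

theorem isIterationMap_zero_fst {Φ : ℝ × (S.bSum × D.𝔰') → S.bSum × D.𝔰'}
    (hΦ : D.IsIterationMap Φ) (x : S.bSum × D.𝔰') : (Φ (0, x)).1 = S.bStar := by
  obtain ⟨_, e⟩ := hΦ.zero x
  rw [e]

theorem splitProduct_zero (x : S.bSum × D.𝔰') : S.splitProduct 0 x.1 x.2 = 1 := by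
  simp [splitProduct]

theorem exists_isExactSplitting :
    ∃ t₀ : ℝ, 0 < t₀ ∧ ∃ (b : ℝ → S.bSum) (s : ℝ → D.𝔰'), D.IsExactSplitting t₀ b s := by
  obtain ⟨Φ, hΦ⟩ := D.exists_isIterationMap
  obtain ⟨y, hy, hy0, hfix⟩ := exists_analyticAt_fixedPoint (hΦ.analyticAt (S.bStar, D.sStar))
    (D.isIterationMap_zero_bStar hΦ D.sStar)
    (spaceDeriv_spaceDeriv_eq_zero (hΦ.analyticAt _).differentiableAt
      (D.isIterationMap_zero_fst hΦ) (D.isIterationMap_zero_bStar hΦ))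
  have ht : Tendsto (fun t => (t, y t)) (𝓝 0) (𝓝 (0, (S.bStar, D.sStar))) := by
    have := (continuousAt_id.prodMk hy.continuousAt).tendsto
    rwa [hy0] at this
  obtain ⟨t₀, ht₀, hball⟩ := Metric.eventually_nhds_iff_ball.1
    (hy.eventually_analyticAt.and (hfix.and (ht.eventually (hΦ.fixed _))))
  rw [Real.ball_eq_Ioo, zero_sub, zero_add] at hball
  refine ⟨t₀, ht₀, fun t => (y t).1, fun t => (y t).2, ⟨fun t h => ?_, fun t h => ?_, ?_, fun t h => ?_⟩⟩
  · exact analyticAt_fst.comp (hball t h).1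
  · exact analyticAt_snd.comp (hball t h).1
  · rw [hy0]
  · by_cases h0 : t = 0
    · rw [h0, D.splitProduct_zero, zero_smul, NormedSpace.exp_zero]
    · exact ((hball t h).2.2 h0).1 (hball t h).2.1

/-- Every exact splitting starts at `(b⋆, s⋆)` and consists of fixed points of the iteration. -/
theorem isExactSplitting_fixed {Φ : ℝ × (S.bSum × D.𝔰') → S.bSum × D.𝔰'}
    (hΦ : D.IsIterationMap Φ) {t₀ : ℝ} (ht₀ : 0 < t₀) {b : ℝ → S.bSum} {s : ℝ → D.𝔰'}
    (h : D.IsExactSplitting t₀ b s) :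
    s 0 = D.sStar ∧ ∀ᶠ t in 𝓝 0, Φ (t, (b t, s t)) = (b t, s t) := by
  have h0 : (0 : ℝ) ∈ Set.Ioo (-t₀) t₀ := ⟨by linarith, ht₀⟩
  have hcb := (h.analytic_b 0 h0).continuousAt
  have hcs := (h.analytic_s 0 h0).continuousAt
  have hc : ContinuousAt (fun t => (t, (b t, s t))) 0 := continuousAt_id.prodMk (hcb.prodMk hcs)
  have hne : ∀ᶠ t in 𝓝 0, t ≠ 0 → Φ (t, (b t, s t)) = (b t, s t) := by
    filter_upwards [hc.eventually (hΦ.fixed (b 0, s 0)), isOpen_Ioo.mem_nhds h0] with t h1 h2 h3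
    exact (h1 h3).2 (h.eq_exp t h2)
  -- The splitting equation is void at t = 0, so the fixed point property there comes from the limit
  -- t → 0, t ≠ 0. It determines s 0, which the definition of an exact splitting leaves free.
  have hlim : Φ (0, (b 0, s 0)) = (b 0, s 0) := by
    have h1 : Tendsto (fun t => Φ (t, (b t, s t))) (𝓝[≠] 0) (𝓝 (Φ (0, (b 0, s 0)))) :=
      (ContinuousAt.comp (f := fun t => (t, (b t, s t))) (x := 0)
        (hΦ.analyticAt (b 0, s 0)).continuousAt hc).tendsto.mono_left nhdsWithin_le_nhds
    have h2 : Tendsto (fun t => (b t, s t)) (𝓝[≠] 0) (𝓝 (b 0, s 0)) :=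
      (hcb.prodMk hcs).tendsto.mono_left nhdsWithin_le_nhds
    refine tendsto_nhds_unique (h1.congr' ?_) h2
    rw [Filter.EventuallyEq, eventually_nhdsWithin_iff]
    exact hne
  refine ⟨?_, hne.mono fun t ht => ?_⟩
  · rw [h.initial, D.isIterationMap_zero_bStar hΦ] at hlim
    exact (congrArg Prod.snd hlim).symm
  · by_cases h0 : t = 0
    · rw [h0]; exact hlim
    · exact ht h0

theorem exists_iteration_convergence {t₀ : ℝ} {b : ℝ → S.bSum} {s : ℝ → D.𝔰'} (ht₀ : 0 < t₀)
    (h : D.IsExactSplitting t₀ b s) :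
    ∃ t₁ : ℝ, 0 < t₁ ∧ t₁ < t₀ ∧
      (∀ t ∈ Set.Ioo (-t₁) t₁, ∃! x : ℕ → S.bSum × D.𝔰', D.IsIteration t x) ∧
      ∃ C : ℝ, 0 < C ∧ ∀ t ∈ Set.Ioo (-t₁) t₁, ∀ x : ℕ → S.bSum × D.𝔰',
        D.IsIteration t x → ∀ k : ℕ, ‖(x k).1 - b t‖ + ‖(x k).2 - s t‖ ≤ C / 2 ^ k := by
  obtain ⟨Φ, hΦ⟩ := D.exists_isIterationMap
  obtain ⟨hs0, hfix⟩ := D.isExactSplitting_fixed hΦ ht₀ h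
  have h0 : (0 : ℝ) ∈ Set.Ioo (-t₀) t₀ := ⟨by linarith, ht₀⟩
  -- The property Q is that the step relation is the graph of Φ. Every iterate stays where this
  -- holds, which gives existence and uniqueness of the sequence.
  have hev := eventually_iterate_dist_le (x₀ := (S.bStar, D.sStar)) (y := fun t => (b t, s t))
    (hΦ.analyticAt _).hasStrictFDerivAt
    (spaceDeriv_spaceDeriv_eq_zero (hΦ.analyticAt _).differentiableAt
      (D.isIterationMap_zero_fst hΦ) (D.isIterationMap_zero_bStar hΦ))
    ((h.analytic_b 0 h0).continuousAt.prodMk (h.analytic_s 0 h0).continuousAt)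
    (by rw [h.initial, hs0]) hfix (hΦ.isStep_iff _)
  obtain ⟨r, hr, hball⟩ := Metric.eventually_nhds_iff_ball.1 hev
  rw [Real.ball_eq_Ioo, zero_sub, zero_add] at hball
  have hmem : ∀ t ∈ Set.Ioo (-min r (t₀ / 2)) (min r (t₀ / 2)), t ∈ Set.Ioo (-r) r := fun t ht =>
    ⟨by linarith [ht.1, min_le_left r (t₀ / 2)], by linarith [ht.2, min_le_left r (t₀ / 2)]⟩
  have hiff : ∀ t ∈ Set.Ioo (-r) r, ∀ x : ℕ → S.bSum × D.𝔰', D.IsIteration t x ↔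
      x = fun k => (fun x => Φ (t, x))^[k] (S.bStar, D.sStar) := by
    intro t ht x
    constructor
    · intro hx
      funext k
      induction k with
      | zero => exact hx.initial
      | succ k ih =>
        have h1 : D.IsStep t (x k) (x (k + 1)) := ⟨hx.step k, hx.step_zero k⟩
        rw [ih, (hball t ht k).1] at h1
        rw [h1, Function.iterate_succ_apply']
    · rintro rfl
      have h1 : ∀ k, D.IsStep t ((fun x => Φ (t, x))^[k] (S.bStar, D.sStar))
          ((fun x => Φ (t, x))^[k + 1] (S.bStar, D.sStar)) := fun k =>
        ((hball t ht k).1 _).2 (Function.iterate_succ_apply' _ _ _)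
      exact ⟨rfl, fun k => (h1 k).1, fun k => (h1 k).2⟩
  -- Halving t₀ makes t₁ < t₀ strict. The constant is C = 2 because each of the two components is
  -- bounded by the product norm, which is at most 2^{-k}.
  refine ⟨min r (t₀ / 2), lt_min hr (by linarith), (min_le_right _ _).trans_lt (by linarith),
    fun t ht => ⟨_, (hiff t (hmem t ht) _).2 rfl, fun x hx => (hiff t (hmem t ht) x).1 hx⟩,
    2, two_pos, fun t ht x hx k => ?_⟩
  have h1 := (hball t (hmem t ht) k).2
  rw [(hiff t (hmem t ht) x).1 hx]
  have h2 := norm_fst_le ((fun x => Φ (t, x))^[k] (S.bStar, D.sStar) - (b t, s t))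
  have h3 := norm_snd_le ((fun x => Φ (t, x))^[k] (S.bStar, D.sStar) - (b t, s t))
  rw [Prod.fst_sub] at h2
  rw [Prod.snd_sub] at h3
  rw [show (2 : ℝ) / 2 ^ k = 1 / 2 ^ k + 1 / 2 ^ k by ring]
  exact add_le_add (h2.trans h1) (h3.trans h1)

end Setting.Decomposition

end ExactSplitting

theorem mainTheorem10 (n m : ℕ) (hm : 0 < m) (S : ExactSplitting.Setting n m) :
    Nonempty S.Decomposition ∧
    ∀ D : S.Decomposition,
      (∃ t₀ : ℝ, 0 < t₀ ∧ ∃ (b : ℝ → S.bSum) (s : ℝ → D.𝔰'), D.IsExactSplitting t₀ b s) ∧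
      ∀ (t₀ : ℝ) (b : ℝ → S.bSum) (s : ℝ → D.𝔰'), 0 < t₀ → D.IsExactSplitting t₀ b s →
        ∃ t₁ : ℝ, 0 < t₁ ∧ t₁ < t₀ ∧
          (∀ t ∈ Set.Ioo (-t₁) t₁, ∃! x : ℕ → S.bSum × D.𝔰', D.IsIteration t x) ∧
          ∃ C : ℝ, 0 < C ∧ ∀ t ∈ Set.Ioo (-t₁) t₁, ∀ x : ℕ → S.bSum × D.𝔰',
            D.IsIteration t x → ∀ k : ℕ,
              ‖(x k).1 - b t‖ + ‖(x k).2 - s t‖ ≤ C / 2 ^ k :=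
  ⟨S.nonempty_decomposition, fun D =>
    ⟨D.exists_isExactSplitting, fun _ _ _ ht₀ h => D.exists_iteration_convergence ht₀ h⟩⟩
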